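/- For positive integers $k,q$ with $k\ge 2q$, the \emph{circular clique} $G_{k,q}$ is the graph with vertex set $\{0,1,\dots,k-1\}$ in which $i$ and $j$ are adjacent when $q\le |i-j|\le k-q$. A \emph{$(k,q)$-colouring} of a graph $X$ is a homomorphism $X\to G_{k,q}$, and $X$ is \emph{$(k,q)$-colourable} if it has one. For subgraphs $A,B$ of $X$, let $d_X(A,B)$ be the least length of a path in $X$ from a vertex of $A$ to a vertex of $B$ ($\infty$ if there is none). \textbf{Theorem.} Let $k,q,k',q'$ be positive integers with $k\ge 2q$, $\gcd(k,q)=1$ and \[ \frac{k'}{q'}\ \ge\ \max\left\{\frac{k+1}{2},\ \left\lceil\frac{k}{q}\right\rceil+1\right\}. \] Then there is a non-negative integer $d$, depending only on $k,q,k',q'$, such that the following holds. Let $X$ be a finite simple $(k,q)$-colourable graph, let $t\ge 0$, and let $X_1,\dots,X_t$ be pairwise vertex-disjoint subgraphs of $X$, each isomorphic to $G_{k,q}$, with $d_X(X_i,X_j)\ge d$ whenever $i\ne j$. Then for all homomorphisms $f_i:X_i\to G_{k',q'}$ $(i=1,\dots,t)$ the precolouring $f_1\cup\dots\cup f_t$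 extends to a $(k',q')$-colouring of $X$; that is, there is a $(k',q')$-colouring of $X$ whose restriction to $X_i$ is $f_i$ for every $i$. -/

import Mathlib

/-- The circular clique `G_{k,q}`: vertices `0, …, k - 1`, with `i` and `j` adjacent when
`q ≤ |i - j| ≤ k - q`.  (The clause `i ≠ j` is automatic for `q ≥ 1`.) -/
def circularClique (k q : ℕ) : SimpleGraph (Fin k) where
  Adj i j := i ≠ j ∧ (q : ℤ) ≤ |(i : ℤ) - (j : ℤ)| ∧ |(i : ℤ) - (j : ℤ)| ≤ (k : ℤ) - (q : ℤ)
  symm := ⟨fun i j h => ⟨h.1.symm, by rw [abs_sub_comm]; exact h.2.1,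
    by rw [abs_sub_comm]; exact h.2.2⟩⟩
  loopless := ⟨fun _ h => h.1 rfl⟩

/-- A `(k,q)`-colouring of a graph is a homomorphism to the circular clique `G_{k,q}`. -/
abbrev CircularColoring {V : Type*} (G : SimpleGraph V) (k q : ℕ) : Type _ :=
  G →g circularClique k q

/-- The distance in `X` between two subgraphs: the least length of a path of `X` from a vertex of
`A` to a vertex of `B`, and `⊤` if there is no such path. -/
noncomputable def subgraphDist {V : Type*} (X : SimpleGraph V) (A B : X.Subgraph) : ℕ∞ :=
  ⨅ u ∈ A.verts, ⨅ v ∈ B.verts, X.edist u v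

/-! Fix a colouring `c : X → G_{k,q}`. Since `gcd(k,q) = 1`, `G_{k,q}` is a core
(`circularClique_endo_bijective`), so `c` is an isomorphism on every `X_i` and each precolouring
factors as `f_i = g_i ∘ c` with `g_i : G_{k,q} → G_{k',q'}`. If every such `g_i` can be joined to
one fixed homomorphism `h₀` by a walk in the exponential graph, colour a vertex `v` at distance `n`
from `X_i` by the `n`-th map of the walk, evaluated at `c v`, and use `h₀ ∘ c` far from all `X_i`
(`exists_hom_of_seq`). There are finitely many `g`, so the lengths of the walks are bounded, which
gives `d`.

What remains is mixing (`exists_forall_homConn`). Write `p = k'`, `r = q'`, `M = ⌊p / r⌋`. A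
counting argument based on `r (k + 1) ≤ 2 p` lets any colouring be moved off a window of `r - 1`
consecutive colours (`exists_homConn_compressed`). The colours then lie in an interval where no
wrap-around occurs, and rounding down to multiples of `r` (`homConn_floor`) leaves an ordinary
proper `M`-colouring of `G_{k,q}`. Proper `M`-colourings are connected
(`exists_homConn_circularClique`): their colour classes can be turned into prescribed intervals of
vertices, fewer than `M` in number, after which the spare colour allows any relabelling. The
compression may introduce a rotation of the colour circle, which `homConn_rotate` undoes. -/

/-- Adjacency of `f` and `g`, both homomorphisms from `G` to the relation `R`, in the exponential
graph. -/
def HomStep {V α : Type*} (G : SimpleGraph V) (R : α → α → Prop) (f g : V → α) : Prop :=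
  ∀ ⦃u v⦄, G.Adj u v → R (f u) (f v) ∧ R (g u) (g v) ∧ R (f u) (g v)

/-- Two maps are connected by a walk of homomorphisms in the exponential graph. -/
abbrev HomConn {V α : Type*} (G : SimpleGraph V) (R : α → α → Prop) : (V → α) → (V → α) → Prop :=
  Relation.ReflTransGen (HomStep G R)

/-! ### Walks in the exponential graph. -/

section HomConn

variable {V α β : Type*} {G : SimpleGraph V} {R : α → α → Prop} {S : β → β → Prop}

theorem HomStep.symm (hR : ∀ x y, R x y → R y x) {f g : V → α} (h : HomStep G R f g) :
    HomStep G R g f :=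
  fun _ _ huv => ⟨(h huv).2.1, (h huv).1, hR _ _ (h huv.symm).2.2⟩

theorem HomConn.symm (hR : ∀ x y, R x y → R y x) {f g : V → α} (h : HomConn G R f g) :
    HomConn G R g f := by
  induction h with
  | refl => exact .refl
  | tail _ hs ih => exact .head (hs.symm hR) ih

theorem HomConn.map (φ : α → β) (hφ : ∀ x y, R x y → S (φ x) (φ y)) {f g : V → α}
    (h : HomConn G R f g) : HomConn G S (fun v => φ (f v)) (fun v => φ (g v)) := by
  induction h with
  | refl => exact .refl
  | tail _ hs ih =>
    exact ih.tail fun _ _ huv => ⟨hφ _ _ (hs huv).1, hφ _ _ (hs huv).2.1, hφ _ _ (hs huv).2.2⟩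

theorem HomConn.isHom {f g : V → α} (h : HomConn G R f g)
    (hf : ∀ u v, G.Adj u v → R (f u) (f v)) : ∀ u v, G.Adj u v → R (g u) (g v) := by
  induction h with
  | refl => exact hf
  | tail _ hs _ => exact fun u v huv => (hs huv).2.1

/-- If the vertices can be recoloured from `f` to `g` in the order of increasing rank, then `f` and
`g` are connected. -/
theorem HomConn.of_rank (hR : ∀ x y, R x y → R y x) {f g : V → α} (σ : V → ℕ) (K : ℕ)
    (hK : ∀ v, σ v < K) (hf : ∀ u v, G.Adj u v → R (f u) (f v))
    (hg : ∀ u v, G.Adj u v → R (g u) (g v))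
    (h : ∀ u v, G.Adj u v → σ u ≤ σ v → R (g u) (f v)) : HomConn G R f g := by
  -- A whole rank class changes in one step, so `h` must also cover adjacent vertices of equal rank.
  have key : ∀ n, HomConn G R f (fun v => if σ v < n then g v else f v) := by
    intro n
    induction n with
    | zero => simpa using Relation.ReflTransGen.refl
    | succ n ih =>
      refine ih.tail fun u v huv => ⟨?_, ?_, ?_⟩
      all_goals
        beta_reduce
        split_ifs
        all_goals first
          | exact hf _ _ huv
          | exact hg _ _ huv
          | exact h _ _ huv (by omega)
          | exact hR _ _ (h _ _ huv.symm (by omega))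
  simpa [hK] using key K

end HomConn

/-! ### Circular colours as integers modulo `p`, and monotone recolouring. -/

/-- Adjacency of integers regarded as colours modulo `p`, at circular distance at least `r`. -/
def CircAdj (p r x y : ℤ) : Prop := ∃ n : ℤ, r ≤ x - y + n * p ∧ x - y + n * p ≤ p - r

section CircAdj

variable {p r : ℤ}

theorem CircAdj.symm (x y : ℤ) (h : CircAdj p r x y) : CircAdj p r y x := by
  obtain ⟨n, h1, h2⟩ := h
  exact ⟨1 - n, by linarith, by linarith⟩

theorem circAdj_of_lt {x y : ℤ} (h1 : x + r ≤ y) (h2 : y ≤ x + p - r) : CircAdj p r x y :=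
  ⟨1, by linarith, by linarith⟩

theorem circAdj_of_gt {x y : ℤ} (h1 : y + r ≤ x) (h2 : x ≤ y + p - r) : CircAdj p r x y :=
  ⟨0, by linarith, by linarith⟩

theorem CircAdj.bounds (hr : 0 < r) {x y : ℤ} (h : CircAdj p r x y) (h1 : x < y + p)
    (h2 : y < x + p) : (x + r ≤ y ∧ y ≤ x + p - r) ∨ (y + r ≤ x ∧ x ≤ y + p - r) := by
  obtain ⟨n, h3, h4⟩ := h
  have hn0 : 0 ≤ n := by
    by_contra hn
    nlinarith
  have hn1 : n ≤ 1 := by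
    by_contra hn
    nlinarith
  obtain rfl | rfl : n = 0 ∨ n = 1 := by omega
  · right; constructor <;> linarith
  · left; constructor <;> linarith

theorem CircAdj.congr {x y x' y' : ℤ} (h : CircAdj p r x y) (hx : ∃ a, x' = x + a * p)
    (hy : ∃ b, y' = y + b * p) : CircAdj p r x' y' := by
  obtain ⟨n, h1, h2⟩ := h
  obtain ⟨a, rfl⟩ := hx
  obtain ⟨b, rfl⟩ := hy
  exact ⟨n - a + b, by linarith, by linarith⟩

theorem CircAdj.add {x y : ℤ} (b : ℤ) (h : CircAdj p r x y) : CircAdj p r (b + x) (b + y) := by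
  obtain ⟨n, h1, h2⟩ := h
  exact ⟨n, by linarith, by linarith⟩

theorem CircAdj.sub {x y : ℤ} (b : ℤ) (h : CircAdj p r x y) : CircAdj p r (b - x) (b - y) := by
  obtain ⟨n, h1, h2⟩ := h.symm
  exact ⟨n, by linarith, by linarith⟩

variable {V : Type*} {G : SimpleGraph V}

/-- `CircAdj` only sees residues modulo `p`, so changing representatives costs a single step. -/
theorem homConn_of_congr {f g : V → ℤ} (hf : ∀ u v, G.Adj u v → CircAdj p r (f u) (f v))
    (hfg : ∀ v, ∃ a, g v = f v + a * p) : HomConn G (CircAdj p r) f g :=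
  .single fun u v huv => ⟨hf u v huv, (hf u v huv).congr (hfg u) (hfg v),
    (hf u v huv).congr ⟨0, by simp⟩ (hfg v)⟩

/-- A colouring by `[0, p - r]` can be pushed down to multiples of `r`. -/
theorem homConn_floor (hr : 0 < r) {f : V → ℤ} (hf : ∀ u v, G.Adj u v → CircAdj p r (f u) (f v))
    (h0 : ∀ v, 0 ≤ f v) (h1 : ∀ v, f v ≤ p - r) :
    HomConn G (CircAdj p r) f (fun v => r * (f v / r)) := by
  have hd : ∀ v, 0 ≤ r * (f v / r) ∧ r * (f v / r) ≤ f v ∧ f v < r * (f v / r) + r := fun v =>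
    ⟨mul_nonneg hr.le (Int.ediv_nonneg (h0 v) hr.le), Int.mul_ediv_self_le hr.ne',
      Int.lt_mul_ediv_self_add hr⟩
  have hlt : ∀ u v, f u + r ≤ f v → r * (f u / r) + r ≤ r * (f v / r) := by
    intro u v h
    have : f u / r + 1 ≤ f v / r := by
      rw [Int.le_ediv_iff_mul_le hr]
      linarith [hd u, mul_comm r (f u / r)]
    nlinarith
  -- Inside `[0, p - r]` adjacency just means a difference of at least `r`; the upper bound is
  -- automatic.
  have hb : ∀ u v, G.Adj u v → f u + r ≤ f v ∨ f v + r ≤ f u := by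
    intro u v huv
    have := (hf u v huv).bounds hr (by linarith [h0 u, h1 u, h0 v, h1 v])
      (by linarith [h0 u, h1 u, h0 v, h1 v])
    omega
  -- Lowest colours move first: a lower neighbour that has already dropped only widens the gap.
  refine HomConn.of_rank CircAdj.symm (fun v => (f v).toNat) (p.toNat + 1) (fun v => ?_) hf ?_ ?_
  · have := h0 v; have := h1 v; omega
  · intro u v huv
    have := hd u; have := hd v; have := h1 u; have := h1 v
    rcases hb u v huv with h | h
    · exact circAdj_of_lt (hlt _ _ h) (by linarith)
    · exact circAdj_of_gt (hlt _ _ h) (by linarith)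
  · intro u v huv hσ
    have := hd u; have := hd v; have := h1 u; have := h1 v
    have := h0 u; have := h0 v
    rcases hb u v huv with h | h
    · exact circAdj_of_lt (by linarith) (by linarith)
    · omega

/-- The vertices other than `v₀` can be raised step by step to at least the levels `T`. -/
theorem homConn_raise (hr : 0 < r) {f T : V → ℤ} {v₀ : V} {y : ℤ} (hy : 0 ≤ y)
    (hf : ∀ u v, G.Adj u v → CircAdj p r (f u) (f v)) (hv₀ : f v₀ = p - r)
    (hf0 : ∀ v, v ≠ v₀ → -y ≤ f v) (hf1 : ∀ v, v ≠ v₀ → f v + y + r + 1 ≤ p)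
    (hyr : y < r)
    (hT0 : ∀ v, v ≠ v₀ → 0 ≤ T v) (hTf : ∀ v, v ≠ v₀ → T v ≤ f v + y)
    (hT : ∀ u v, u ≠ v₀ → v ≠ v₀ → f u + r ≤ f v → T u + r ≤ T v)
    (hTv : ∀ v, v ≠ v₀ → f v ≤ p - 2 * r → T v ≤ p - 2 * r) (hTv₀ : T v₀ ≤ p - r) :
    HomConn G (CircAdj p r) f (fun v => max (f v) (T v)) := by
  have hb : ∀ u v, u ≠ v₀ → v ≠ v₀ → G.Adj u v →
      (f u + r ≤ f v ∧ f v ≤ f u + p - r) ∨ (f v + r ≤ f u ∧ f u ≤ f v + p - r) := by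
    intro u v hu hv huv
    have := hf0 u hu; have := hf0 v hv; have := hf1 u hu; have := hf1 v hv
    exact (hf u v huv).bounds hr (by omega) (by omega)
  have hb0 : ∀ u, G.Adj u v₀ → u ≠ v₀ ∧ 0 ≤ f u ∧ f u ≤ p - 2 * r := by
    intro u huv
    have hne : u ≠ v₀ := huv.ne
    have := hf0 u hne; have := hf1 u hne
    have := (hf u v₀ huv).bounds hr (by omega) (by omega)
    exact ⟨hne, by omega, by omega⟩
  classical
  -- A rising floor `T - y + t`: at `t = 0` it is below `f` because `T ≤ f + y`, and at `t = y` it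
  -- is `T`. The gap condition on `T` preserves gaps of `r` throughout, while `v₀` stays at `p - r`
  -- and its neighbours stay at most `p - 2r`.
  obtain ⟨h, h_v₀, h_ne⟩ : ∃ h : ℤ → V → ℤ, (∀ t, h t v₀ = p - r) ∧
      ∀ t v, v ≠ v₀ → h t v = max (f v) (T v - y + t) :=
    ⟨fun t v => if v = v₀ then p - r else max (f v) (T v - y + t), fun t => if_pos rfl,
      fun t v hv => if_neg hv⟩
  have hv0adj : ∀ t t' u, 0 ≤ t → t ≤ y → G.Adj u v₀ → CircAdj p r (h t u) (h t' v₀) := by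
    intro t t' u ht0 ht huv
    obtain ⟨hne, h1, h2⟩ := hb0 u huv
    have := hTv u hne h2
    rw [h_v₀, h_ne t u hne]
    exact circAdj_of_lt (by omega) (by omega)
  have hup : ∀ t u v, 0 ≤ t → t ≤ y → u ≠ v₀ → v ≠ v₀ → f u + r ≤ f v → f v ≤ f u + p - r →
      h t u + r ≤ h t v ∧ h t u + r ≤ h (t + 1) v ∧ h t v ≤ h t u + p - r ∧
      h (t + 1) v ≤ h t u + p - r := by
    intro t u v ht0 ht hu hv h1 h2
    have := hT u v hu hv h1
    have := hTf u hu; have := hTf v hv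
    have := hT0 u hu; have := hT0 v hv; have := hf1 v hv
    simp only [h_ne _ _ hu, h_ne _ _ hv]
    omega
  have hhom : ∀ t, 0 ≤ t → t ≤ y → ∀ u v, G.Adj u v → CircAdj p r (h t u) (h t v) := by
    intro t ht0 ht u v huv
    by_cases hu : u = v₀
    · subst hu
      exact (hv0adj t t v ht0 ht huv.symm).symm
    by_cases hv : v = v₀
    · subst hv
      exact hv0adj t t u ht0 ht huv
    rcases hb u v hu hv huv with ⟨h1, h2⟩ | ⟨h1, h2⟩
    · have := hup t u v ht0 ht hu hv h1 h2
      exact circAdj_of_lt this.1 this.2.2.1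
    · have := hup t v u ht0 ht hv hu h1 h2
      exact circAdj_of_gt this.1 this.2.2.1
  have hstep : ∀ t, 0 ≤ t → t + 1 ≤ y → HomConn G (CircAdj p r) (h t) (h (t + 1)) := by
    intro t ht0 ht
    -- Within a unit step the highest colours move first, making room for the lower ones.
    refine HomConn.of_rank CircAdj.symm (fun v => (p - f v).toNat) ((p + y).toNat + r.toNat + 1)
      (fun v => ?_) (hhom t ht0 (by omega)) (hhom (t + 1) (by omega) ht) ?_
    · by_cases hv : v = v₀
      · rw [hv, hv₀]; omega
      · have := hf0 v hv; omega
    · intro u v huv hσ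
      by_cases hu : u = v₀
      · subst hu
        exact (hv0adj t (t + 1) v ht0 (by omega) huv.symm).symm
      by_cases hv : v = v₀
      · subst hv
        exact hv0adj (t + 1) t u (by omega) ht huv
      have := hf1 u hu; have := hf1 v hv
      rcases hb u v hu hv huv with ⟨h1, h2⟩ | ⟨h1, h2⟩
      · omega
      · have := hup t v u ht0 (by omega) hv hu h1 h2
        exact circAdj_of_gt this.2.1 this.2.2.2
  have hall : ∀ n : ℕ, (n : ℤ) ≤ y → HomConn G (CircAdj p r) (h 0) (h n) := by
    intro n
    induction n with
    | zero => intro _; exact .refl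
    | succ n ih =>
      intro hn
      push_cast at hn ⊢
      exact (ih (by omega)).trans (hstep n (by omega) hn)
  have e0 : h 0 = f := by
    funext v
    by_cases hv : v = v₀
    · rw [hv, h_v₀, hv₀]
    · have := hTf v hv
      rw [h_ne 0 v hv]; omega
  have e1 : h (y.toNat : ℕ) = fun v => max (f v) (T v) := by
    funext v
    by_cases hv : v = v₀
    · rw [hv, h_v₀, hv₀]; omega
    · rw [h_ne _ v hv]; omega
  have := hall y.toNat (by omega)
  rwa [e0, e1] at this

end CircAdj

/-! ### Compressing a circular colouring into an interval. -/

section Window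

variable {p r : ℤ} {V : Type*} {G : SimpleGraph V}

/-- Double counting: each vertex lies in `r` of the `p` cyclic windows of length `r`, so if every
window held two vertices then `2p ≤ r |V|`. -/
theorem exists_window_subsingleton [Fintype V] (hp : 0 < p) (hr : 0 < r)
    (hN : r * Fintype.card V < 2 * p) (f : V → ℤ) :
    ∃ a, ∀ u v, (f u - a) % p < r → (f v - a) % p < r → u = v := by
  classical
  by_contra! hcon
  have h1 : ∀ a ∈ Finset.Ico 0 p, 2 ≤ (Finset.univ.filter fun v => (f v - a) % p < r).card := by
    intro a _
    obtain ⟨u, v, hu, hv, huv⟩ := hcon a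
    exact Finset.one_lt_card.2 ⟨u, by simpa using hu, v, by simpa using hv, huv⟩
  have h2 : ∀ v ∈ (Finset.univ : Finset V),
      ((Finset.Ico 0 p).filter fun a => (f v - a) % p < r).card ≤ r.toNat := by
    intro v _
    have : r.toNat = (Finset.Ico 0 r).card := by simp
    rw [this]
    refine Finset.card_le_card_of_injOn (fun a => (f v - a) % p) ?_ ?_
    · intro a ha
      simp only [Finset.coe_filter, Finset.mem_Ico, Set.mem_ofPred_eq] at ha
      simpa using ⟨Int.emod_nonneg _ hp.ne', ha.2⟩
    · intro a ha b hb hab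
      simp only [Finset.coe_filter, Finset.mem_Ico, Set.mem_ofPred_eq] at ha hb
      have h : (f v - a) % p = (f v - b) % p := hab
      have h4 : p ∣ b - a := by
        have := Int.emod_eq_emod_iff_emod_sub_eq_zero.1 h
        have := Int.dvd_of_emod_eq_zero this
        rwa [show f v - a - (f v - b) = b - a by ring] at this
      have h5 := Int.eq_zero_of_abs_lt_dvd h4 (by rw [abs_lt]; constructor <;> linarith)
      linarith
  have h3 := Finset.sum_card_bipartiteAbove_eq_sum_card_bipartiteBelow
    (s := Finset.Ico 0 p) (t := (Finset.univ : Finset V)) (fun a v => (f v - a) % p < r)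
  have h4 := Finset.card_nsmul_le_sum _ _ _ h1
  have h5 := Finset.sum_le_card_nsmul _ _ _ h2
  simp only [Finset.bipartiteAbove, Finset.bipartiteBelow] at h3
  rw [h3] at h4
  have h6 := h4.trans h5
  simp only [Int.card_Ico, sub_zero, smul_eq_mul, Finset.card_univ] at h6
  zify at h6
  rw [Int.toNat_of_nonneg hp.le, Int.toNat_of_nonneg hr.le] at h6
  linarith

/-- If exactly one colour lies in `[0, r)` and some further bin of colours is empty, then the
colouring can be compressed to an interval of length `p - r`. -/
theorem exists_homConn_compressed_of_empty_bin (hr : 0 < r) {f : V → ℤ} {v₀ : V} {m s j : ℤ}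
    (hp : p = m * r + s) (hs0 : 0 ≤ s) (hj0 : 0 ≤ j) (hj : j < m)
    (hf : ∀ u v, G.Adj u v → CircAdj p r (f u) (f v))
    (hy : 0 ≤ f v₀) (hyr : f v₀ < r) (hf0 : ∀ v, v ≠ v₀ → r ≤ f v) (hf1 : ∀ v, f v < p)
    (hbin : ∀ v, r + j * r ≤ f v → s + f v₀ + j * r < f v) :
    ∃ (b : ℤ) (f' : V → ℤ), HomConn G (CircAdj p r) f (fun v => b + f' v) ∧
      ∀ v, 0 ≤ f' v ∧ f' v ≤ p - r := by
  classical
  have hjm : j * r + r ≤ m * r := by nlinarith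
  have hjr : 0 ≤ j * r := mul_nonneg hj0 hr.le
  set y := f v₀ with hydef
  -- The bound `e ≤ r - 1 - s` ensures that a colour at most `p - 2r = (m - 2) r + s` stays below
  -- `(m - 1) r` when `e` is added, so rounding down cannot bring it too close to `v₀` at `p - r`.
  set e := min y (r - 1 - s) with he
  have hfl : ∀ z : ℤ, r * (z / r) ≤ z ∧ z < r * (z / r) + r := fun z =>
    ⟨Int.mul_ediv_self_le hr.ne', Int.lt_mul_ediv_self_add hr⟩
  have hflt : ∀ z i : ℤ, z < i * r → r * (z / r) + r ≤ i * r := by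
    intro z i h
    have := Int.ediv_lt_of_lt_mul hr h
    nlinarith
  have hfle : ∀ z i : ℤ, i * r ≤ z → i * r ≤ r * (z / r) := by
    intro z i h
    have := (Int.le_ediv_iff_mul_le hr).2 h
    nlinarith
  have hfadd : ∀ z z' : ℤ, z + r ≤ z' → r * (z / r) + r ≤ r * (z' / r) := by
    intro z z' h
    have := hfle z' (z / r + 1) (by linarith [hfl z, mul_comm r (z / r)])
    linarith
  -- Rotate so that `v₀` gets `p - r`. The other colours start at `-y`, and the negative ones have
  -- to be raised.
  obtain ⟨f₁, h₁v₀, h₁⟩ : ∃ f₁ : V → ℤ, f₁ v₀ = p - r ∧ ∀ v, v ≠ v₀ → f₁ v = f v - y - r :=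
    ⟨fun v => if v = v₀ then p - r else f v - y - r, if_pos rfl, fun v hv => if_neg hv⟩
  -- Below the empty bin the target is rounded after adding `y`, above it after adding only `e`.
  -- Emptiness of the bin gives `j * r ≤ f₁ v + e` above it, so the two rules keep gaps of `r`
  -- across the change.
  obtain ⟨T, hTv₀, hT⟩ : ∃ T : V → ℤ, T v₀ = 0 ∧ ∀ v, v ≠ v₀ →
      (f₁ v < j * r - y ∧ T v = r * ((f₁ v + y) / r)) ∨
      (j * r ≤ f₁ v + e ∧ T v = r * ((f₁ v + e) / r)) := by
    refine ⟨fun v => if v = v₀ then 0 else if f₁ v < j * r - y then r * ((f₁ v + y) / r) else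
      r * ((f₁ v + e) / r), if_pos rfl, fun v hv => ?_⟩
    simp only [if_neg hv]
    split_ifs with h
    · exact .inl ⟨h, rfl⟩
    · refine .inr ⟨?_, rfl⟩
      have := hbin v; have := h₁ v hv
      omega
  have hcol : ∀ v, ∃ a, f₁ v = (-(y + r) + f v) + a * p := by
    intro v
    by_cases hv : v = v₀
    · exact ⟨1, by rw [hv, h₁v₀, ← hydef]; ring⟩
    · exact ⟨0, by rw [h₁ v hv]; ring⟩
  have hf₁ : ∀ u v, G.Adj u v → CircAdj p r (f₁ u) (f₁ v) := fun u v huv =>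
    ((hf u v huv).add _).congr (hcol u) (hcol v)
  have hx0 : ∀ v, v ≠ v₀ → -y ≤ f₁ v := fun v hv => by
    have := hf0 v hv; have := h₁ v hv; omega
  have hx1 : ∀ v, v ≠ v₀ → f₁ v + y + r + 1 ≤ p := fun v hv => by
    have := hf1 v; have := h₁ v hv; omega
  have hT0 : ∀ v, v ≠ v₀ → 0 ≤ T v := by
    intro v hv
    have := hx0 v hv
    rcases hT v hv with ⟨_, h⟩ | ⟨h', h⟩ <;> rw [h]
    · simpa using hfle (f₁ v + y) 0 (by omega)
    · simpa using hfle (f₁ v + e) 0 (by omega)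
  have hTf : ∀ v, v ≠ v₀ → T v ≤ f₁ v + y := by
    intro v hv
    rcases hT v hv with ⟨_, h⟩ | ⟨h', h⟩ <;> rw [h]
    · exact (hfl _).1
    · have := (hfl (f₁ v + e)).1; omega
  have hraise := homConn_raise (T := T) hr hy hf₁ h₁v₀ hx0 hx1 hyr hT0 hTf
    (by
      intro u v hu hv huv
      rcases hT u hu with ⟨hu', h⟩ | ⟨hu', h⟩ <;> rcases hT v hv with ⟨hv', h'⟩ | ⟨hv', h'⟩ <;>
        rw [h, h']
      · exact hfadd _ _ (by omega)
      · exact (hflt _ j (by omega)).trans (hfle _ j hv')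
      · omega
      · exact hfadd _ _ (by omega))
    (by
      intro v hv hle
      have hm : (m - 1) * r = m * r - r := by ring
      rcases hT v hv with ⟨hv', h⟩ | ⟨hv', h⟩ <;> rw [h]
      · have := hflt (f₁ v + y) j (by omega); omega
      · have := hflt (f₁ v + e) (m - 1) (by omega); omega)
    (by omega)
  refine ⟨y + r, fun v => max (f₁ v) (T v), ?_, fun v => ?_⟩
  · refine (homConn_of_congr hf (g := fun v => y + r + f₁ v) fun v => ?_).trans
      (hraise.map (fun x => y + r + x) fun _ _ h => h.add _)
    obtain ⟨a, ha⟩ := hcol v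
    exact ⟨a, by rw [ha]; ring⟩
  · beta_reduce
    by_cases hv : v = v₀
    · rw [hv, h₁v₀, hTv₀]; omega
    · have := hT0 v hv; have := hTf v hv; have := hx1 v hv; omega

/-- A colouring of a graph with at most `2p / r - 1` vertices can be compressed to an interval of
length `p - r`. -/
theorem exists_homConn_compressed [Fintype V] (hr : 0 < r) (hrp : r ≤ p)
    (hN : r * (Fintype.card V + 1) ≤ 2 * p) {f : V → ℤ}
    (hf : ∀ u v, G.Adj u v → CircAdj p r (f u) (f v)) :
    ∃ (b : ℤ) (f' : V → ℤ), HomConn G (CircAdj p r) f (fun v => b + f' v) ∧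
      ∀ v, 0 ≤ f' v ∧ f' v ≤ p - r := by
  have hp0 : 0 < p := hr.trans_le hrp
  obtain ⟨a, ha⟩ := exists_window_subsingleton hp0 hr (by linarith) f
  obtain ⟨g, hg⟩ : ∃ g : V → ℤ, ∀ v, g v = (f v - a) % p := ⟨_, fun _ => rfl⟩
  have hfg : ∀ v, ∃ n, f v = a + g v + n * p := fun v =>
    ⟨(f v - a) / p, by have := Int.emod_add_mul_ediv (f v - a) p; rw [hg]; linarith⟩
  have hgf : ∀ v, ∃ n, a + g v = f v + n * p := fun v => by
    obtain ⟨n, hn⟩ := hfg v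
    exact ⟨-n, by linarith⟩
  have hg0 : ∀ v, 0 ≤ g v := fun v => by rw [hg]; exact Int.emod_nonneg _ hp0.ne'
  have hg1 : ∀ v, g v < p := fun v => by rw [hg]; exact Int.emod_lt_of_pos _ hp0
  have hghom : ∀ u v, G.Adj u v → CircAdj p r (g u) (g v) := fun u v huv => by
    have := ((hf u v huv).congr (hgf u) (hgf v)).add (-a)
    simpa using this
  suffices h : ∃ (b : ℤ) (f' : V → ℤ), HomConn G (CircAdj p r) g (fun v => b + f' v) ∧
      ∀ v, 0 ≤ f' v ∧ f' v ≤ p - r by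
    obtain ⟨b, f', h, hf'⟩ := h
    refine ⟨a + b, f', ?_, hf'⟩
    have h' := h.map (S := CircAdj p r) (fun x => a + x) fun _ _ h => h.add _
    simp only [← add_assoc] at h'
    exact (homConn_of_congr hf hgf).trans h'
  by_cases hw : ∃ v₀, g v₀ < r
  swap
  · push Not at hw
    refine ⟨r, fun v => g v - r, by simpa using Relation.ReflTransGen.refl, fun v => ?_⟩
    have := hw v; have := hg1 v
    constructor <;> linarith
  obtain ⟨v₀, hv₀⟩ := hw
  have hne : ∀ v, v ≠ v₀ → r ≤ g v := by
    intro v hv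
    by_contra! h
    rw [hg] at h hv₀
    exact hv (ha v v₀ h hv₀)
  obtain ⟨m, s, hps, hs0, hs⟩ : ∃ m s, p = m * r + s ∧ 0 ≤ s ∧ s < r :=
    ⟨p / r, p % r, (Int.ediv_mul_add_emod p r).symm, Int.emod_nonneg _ hr.ne',
      Int.emod_lt_of_pos _ hr⟩
  -- Two families of bins: offsets `0` to `s + g v₀ - r` (residues below `g v₀`) and offsets `g v₀`
  -- to `s - 1` in the blocks of length `r` after `[0, r)`. The reflection `x ↦ r - 1 - x` modulo
  -- `p` exchanges the families, with `j` becoming `m - 1 - j`.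
  by_cases hbin₁ : ∃ j, 0 ≤ j ∧ j < m ∧ ∀ v, r + j * r ≤ g v → s + g v₀ + j * r < g v
  · obtain ⟨j, hj0, hj, hbin⟩ := hbin₁
    exact exists_homConn_compressed_of_empty_bin hr hps hs0 hj0 hj hghom (hg0 v₀) hv₀ hne hg1
      hbin
  by_cases hbin₂ : ∃ j, 0 ≤ j ∧ j < m ∧ ∀ v, g v ≤ s + r - 1 + j * r → g v < g v₀ + r + j * r
  · obtain ⟨j, hj0, hj, hbin⟩ := hbin₂
    obtain ⟨f₂, h₂v₀, h₂⟩ : ∃ f₂ : V → ℤ, f₂ v₀ = r - 1 - g v₀ ∧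
        ∀ v, v ≠ v₀ → f₂ v = p + r - 1 - g v := by
      classical
      exact ⟨fun v => if v = v₀ then r - 1 - g v₀ else p + r - 1 - g v, if_pos rfl,
        fun v hv => if_neg hv⟩
    have hcol : ∀ v, ∃ n, f₂ v = (p + r - 1 - g v) + n * p := by
      intro v
      by_cases hv : v = v₀
      · exact ⟨-1, by rw [hv, h₂v₀]; ring⟩
      · exact ⟨0, by rw [h₂ v hv]; ring⟩
    obtain ⟨b, f', h, hf'⟩ := exists_homConn_compressed_of_empty_bin (p := p) (f := f₂) (v₀ := v₀)
      (j := m - 1 - j) (G := G) hr hps hs0 (by omega) (by omega)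
      (fun u v huv => ((hghom u v huv).sub _).congr (hcol u) (hcol v))
      (by omega) (by have := hg0 v₀; omega)
      (fun v hv => by have := hg1 v; have := h₂ v hv; omega)
      (fun v => by
        by_cases hv : v = v₀
        · have := hg0 v₀; rw [hv, h₂v₀]; omega
        · have := hne v hv; rw [h₂ v hv]; omega)
      (fun v hv => by
        have e1 : (m - 1 - j) * r = m * r - r - j * r := by ring
        rw [e1] at hv ⊢
        by_cases hvv : v = v₀
        · have := hg0 v₀
          have : j * r + r ≤ m * r := by nlinarith
          rw [hvv, h₂v₀] at hv; omega
        · have := hbin v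
          rw [h₂ v hvv] at hv ⊢
          omega)
    refine ⟨p + r - 1 - b - (p - r), fun v => p - r - f' v, ?_, fun v => ?_⟩
    · have h' := h.map (S := CircAdj p r) (fun x => p + r - 1 - x) fun _ _ h => h.sub _
      have e2 : (fun v => p + r - 1 - (b + f' v)) =
          fun v => p + r - 1 - b - (p - r) + (p - r - f' v) := by
        funext v; ring
      rw [e2] at h'
      refine (homConn_of_congr hghom fun v => ?_).trans h'
      obtain ⟨n, hn⟩ := hcol v
      exact ⟨-n, by rw [hn]; ring⟩
    · have := hf' v
      constructor <;> linarith
  -- If all `2m` bins are occupied, their vertices and `v₀` are distinct, told apart by the quotient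
  -- by `r` and by whether the remainder is below `g v₀`. Then `2m + 1 ≤ |V|`, so `r (2m + 2) ≤ 2p =
  -- 2 (m r + s)`, contradicting `s < r`.
  exfalso
  push Not at hbin₁ hbin₂
  have hm0 : 0 ≤ m := by
    by_contra! h
    nlinarith
  lift m to ℕ using hm0
  choose w hw₁ hw₂ using fun j : Fin m =>
    hbin₁ (j : ℤ) (by positivity) (by exact_mod_cast j.2)
  choose u hu₁ hu₂ using fun j : Fin m =>
    hbin₂ (j : ℤ) (by positivity) (by exact_mod_cast j.2)
  let Φ : Option (Fin m × Bool) → V := fun o =>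
    o.elim v₀ fun x => if x.2 then w x.1 else u x.1
  let κ : V → ℤ × Bool := fun v => (g v / r, decide (g v % r < g v₀))
  have key : ∀ (v : V) (j t : ℤ), g v = t + r * j → 0 ≤ t → t < r →
      κ v = (j, decide (t < g v₀)) := by
    intro v j t h h0 h1
    simp only [κ, h]
    rw [Int.add_mul_ediv_left _ _ hr.ne', Int.ediv_eq_zero_of_lt h0 h1, Int.add_mul_emod_self_left,
      Int.emod_eq_of_lt h0 h1, zero_add]
  have hg₀ := hg0 v₀
  have hκ : ∀ o, κ (Φ o) = o.elim (0, decide (g v₀ < g v₀)) fun x => ((x.1 : ℤ) + 1, x.2) := by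
    rintro (_ | ⟨j, _ | _⟩)
    · exact key v₀ 0 _ (by ring) hg₀ hv₀
    · have h1 := hu₁ j; have h2 := hu₂ j
      refine (key (u j) (j + 1) (g (u j) - r * (j + 1)) (by ring) (by linarith)
        (by linarith)).trans ?_
      simp only [Option.elim, Prod.mk.injEq, true_and, decide_eq_false_iff_not]
      linarith
    · have h1 := hw₁ j; have h2 := hw₂ j
      refine (key (w j) (j + 1) (g (w j) - r * (j + 1)) (by ring) (by linarith)
        (by linarith)).trans ?_
      simp only [Option.elim, Prod.mk.injEq, true_and, decide_eq_true_eq]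
      linarith
  have hinj : Function.Injective Φ := by
    intro o o' h
    have h' : κ (Φ o) = κ (Φ o') := congrArg κ h
    rw [hκ, hκ] at h'
    rcases o with _ | ⟨j, x⟩ <;> rcases o' with _ | ⟨j', x'⟩
    · rfl
    · simp only [Option.elim, Prod.mk.injEq] at h'; omega
    · simp only [Option.elim, Prod.mk.injEq] at h'; omega
    · simp only [Option.elim, Prod.mk.injEq] at h'
      have : j = j' := Fin.ext (by omega)
      rw [this, h'.2]
  have hcard := Fintype.card_le_of_injective Φ hinj
  simp only [Fintype.card_option, Fintype.card_prod, Fintype.card_fin, Fintype.card_bool] at hcard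
  zify at hcard
  nlinarith

end Window

/-! ### Recolouring until the colour classes are prescribed blocks. -/

section Blocks

set_option linter.unusedSectionVars false

variable {V α β : Type*} [Fintype V] [DecidableEq V] [DecidableEq α] [DecidableEq β]
  {G : SimpleGraph V} {g : V → β}

/-- The vertices of `U` that are alone in their fibre of `g`. -/
def singletonFibers (g : V → β) (U : Finset V) : Finset V :=
  U.filter fun v => ∀ w, g w = g v → w = v

theorem mem_singletonFibers {U : Finset V} {v : V} :
    v ∈ singletonFibers g U ↔ v ∈ U ∧ ∀ w, g w = g v → w = v := Finset.mem_filter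

/-- From `c` one can recolour the vertices of `U`, with the colours `C`, so that the colour classes
on `U` become the fibres of `g`. -/
def BlockRecolorable (G : SimpleGraph V) (g : V → β) (U : Finset V) (C : Finset α) (c : V → α) :
    Prop :=
  ∃ c', HomConn G (· ≠ ·) c c' ∧ (∀ v, v ∉ U → c' v = c v) ∧ (∀ v ∈ U, c' v ∈ C) ∧
    ∀ v ∈ U, ∀ w ∈ U, c' v = c' w ↔ g v = g w

/-- If the colour `x` is used at most at `v`, the whole fibre of `v` can be recoloured to `x`. -/
theorem BlockRecolorable.of_step (hg : ∀ u v, G.Adj u v → g u ≠ g v) {U : Finset V} {C : Finset α}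
    (hU : ∀ v ∈ U, ∀ w, g w = g v → w ∈ U) {c : V → α} (hc : ∀ u v, G.Adj u v → c u ≠ c v)
    (hcU : ∀ v, v ∈ U ↔ c v ∈ C) {x : α} (hx : x ∈ C) {v : V} (hv : v ∈ U)
    (hxv : ∀ w, c w = x → w = v)
    (h : ∀ c₁ : V → α, (∀ u v, G.Adj u v → c₁ u ≠ c₁ v) →
      (∀ w, w ∈ U.filter (fun w => g w ≠ g v) ↔ c₁ w ∈ C.erase x) →
      BlockRecolorable G g (U.filter fun w => g w ≠ g v) (C.erase x) c₁) :
    BlockRecolorable G g U C c := by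
  obtain ⟨c₁, h₁v, h₁⟩ : ∃ c₁ : V → α, (∀ w, g w = g v → c₁ w = x) ∧
      ∀ w, g w ≠ g v → c₁ w = c w :=
    ⟨fun w => if g w = g v then x else c w, fun w hw => if_pos hw, fun w hw => if_neg hw⟩
  have hne : ∀ w, g w ≠ g v → c w ≠ x := fun w hw h => hw (by rw [hxv w h])
  have hc₁ : ∀ u w, G.Adj u w → c₁ u ≠ c₁ w ∧ c u ≠ c₁ w := by
    intro u w huw
    have hguw := hg u w huw
    have hcuw := hc u w huw
    by_cases hu : g u = g v <;> by_cases hw : g w = g v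
    · exact absurd (hu.trans hw.symm) hguw
    · rw [h₁v u hu, h₁ w hw]; exact ⟨(hne w hw).symm, hcuw⟩
    · rw [h₁v w hw, h₁ u hu]; exact ⟨hne u hu, hne u hu⟩
    · rw [h₁ u hu, h₁ w hw]; exact ⟨hcuw, hcuw⟩
  have hU₁ : ∀ w, w ∈ U.filter (fun w => g w ≠ g v) ↔ c₁ w ∈ C.erase x := by
    intro w
    rw [Finset.mem_filter, Finset.mem_erase]
    by_cases hw : g w = g v
    · simp [hw, h₁v w hw]
    · simp [hw, h₁ w hw, hne w hw, hcU w]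
  obtain ⟨c', h1, h2, h3, h4⟩ := h c₁ (fun u w huw => (hc₁ u w huw).1) hU₁
  have hS : ∀ w, g w = g v → c' w = x := fun w hw => by rw [h2 w (by simp [hw]), h₁v w hw]
  have hnS : ∀ w ∈ U, g w ≠ g v → c' w ∈ C ∧ c' w ≠ x := fun w hwU hw => by
    have := Finset.mem_erase.1 (h3 w (Finset.mem_filter.2 ⟨hwU, hw⟩))
    exact ⟨this.2, this.1⟩
  refine ⟨c', .head (fun u w huw => ⟨hc u w huw, hc₁ u w huw⟩) h1, ?_, ?_, ?_⟩
  · intro w hw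
    have hwv : g w ≠ g v := fun h => hw (hU v hv w h)
    rw [h2 w (by simp [hw]), h₁ w hwv]
  · intro w hw
    by_cases hwv : g w = g v
    · rwa [hS w hwv]
    · exact (hnS w hw hwv).1
  · intro u hu w hw
    by_cases huv : g u = g v <;> by_cases hwv : g w = g v
    · simp [hS u huv, hS w hwv, huv, hwv]
    · rw [hS u huv, huv]
      exact ⟨fun h => absurd h.symm (hnS w hw hwv).2, fun h => absurd h.symm hwv⟩
    · rw [hS w hwv, hwv]
      exact ⟨fun h => absurd h (hnS u hu huv).2, fun h => absurd h huv⟩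
    · exact h4 u (Finset.mem_filter.2 ⟨hu, huv⟩) w (Finset.mem_filter.2 ⟨hw, hwv⟩)

theorem card_filter_ne_add {U : Finset V} (hU : ∀ v ∈ U, ∀ w, g w = g v → w ∈ U) {v : V}
    (hv : v ∈ U) :
    (U.filter fun w => g w ≠ g v).card + (Finset.univ.filter fun w => g w = g v).card = U.card := by
  rw [← Finset.card_filter_add_card_filter_not (s := U) (fun w => g w = g v), add_comm]
  congr 2
  ext w
  simp only [Finset.mem_filter, Finset.mem_univ, true_and]
  exact ⟨fun h => ⟨hU v hv w h, h⟩, fun h => h.2⟩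

theorem singletonFibers_mono {U U' : Finset V} (h : U ⊆ U') :
    singletonFibers g U ⊆ singletonFibers g U' := Finset.filter_subset_filter _ h

/-- The potential `|U|` plus the number of singleton fibres drops by at least 2 per removed fibre: a
singleton counts twice, any other fibre has at least two vertices. -/
theorem card_filter_ne_add_two_le {U : Finset V} (hU : ∀ v ∈ U, ∀ w, g w = g v → w ∈ U) {v : V}
    (hv : v ∈ U) :
    (U.filter fun w => g w ≠ g v).card + (singletonFibers g (U.filter fun w => g w ≠ g v)).card + 2
      ≤ U.card + (singletonFibers g U).card := by
  have h1 := card_filter_ne_add hU hv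
  by_cases hs : ∀ w, g w = g v → w = v
  · have h2 : (Finset.univ.filter fun w => g w = g v).card = 1 := by
      rw [Finset.card_eq_one]
      exact ⟨v, by ext w; simpa using ⟨hs w, fun h => by rw [h]⟩⟩
    have h3 : (singletonFibers g (U.filter fun w => g w ≠ g v)).card < (singletonFibers g U).card := by
      refine Finset.card_lt_card ((Finset.ssubset_iff_of_subset
        (singletonFibers_mono (Finset.filter_subset _ _))).2 ⟨v, ?_, ?_⟩)
      · exact Finset.mem_filter.2 ⟨hv, hs⟩
      · simp [singletonFibers]
    omega
  · push Not at hs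
    obtain ⟨w, hw, hwv⟩ := hs
    have h2 : 1 < (Finset.univ.filter fun w => g w = g v).card :=
      Finset.one_lt_card.2 ⟨w, by simpa using hw, v, by simp, hwv⟩
    have h3 := Finset.card_le_card (singletonFibers_mono (g := g)
      (Finset.filter_subset (fun w => g w ≠ g v) U))
    omega

/-- Some colour is used at most once if there are fewer than twice as many vertices as colours. -/
theorem exists_color_subsingleton {U : Finset V} (hUne : U.Nonempty) {C : Finset α} {c : V → α}
    (hcU : ∀ v, v ∈ U ↔ c v ∈ C) (hcard : U.card < 2 * C.card) :
    ∃ x ∈ C, ∃ v ∈ U, ∀ w, c w = x → w = v := by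
  obtain ⟨x, hx, hlt⟩ := Finset.exists_card_fiber_lt_of_card_lt_mul (f := c) (n := 2)
    (s := U) (t := C) (by linarith)
  by_cases h : ∃ v, c v = x
  · obtain ⟨v, hv⟩ := h
    refine ⟨x, hx, v, (hcU v).2 (hv ▸ hx), fun w hw => ?_⟩
    by_contra hne
    have : 1 < (U.filter fun v => c v = x).card := Finset.one_lt_card.2
      ⟨w, by simpa [hw] using (hcU w).2 (hw ▸ hx), v, by simpa [hv] using (hcU v).2 (hv ▸ hx), hne⟩
    omega
  · obtain ⟨v, hv⟩ := hUne
    exact ⟨x, hx, v, hv, fun w hw => absurd ⟨w, hw⟩ h⟩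

/-- Greedy: a colour used at most once can take over a whole fibre, which is then set aside together
with that colour. The left side of the cardinality bound falls by at least 2 and the right side by
exactly 2, so the bound persists. -/
theorem blockRecolorable_of_card (hg : ∀ u v, G.Adj u v → g u ≠ g v) (n : ℕ) :
    ∀ (U : Finset V) (C : Finset α), U.card = n → (∀ v ∈ U, ∀ w, g w = g v → w ∈ U) →
    ∀ c : V → α, (∀ u v, G.Adj u v → c u ≠ c v) → (∀ v, v ∈ U ↔ c v ∈ C) →
    U.card + (singletonFibers g U).card + 1 ≤ 2 * C.card → BlockRecolorable G g U C c := by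
  induction n using Nat.strong_induction_on with
  | _ n ih =>
    intro U C hn hU c hc hcU hcard
    rcases U.eq_empty_or_nonempty with rfl | hUne
    · exact ⟨c, .refl, by simp, by simp, by simp⟩
    obtain ⟨x, hx, v, hv, hxv⟩ := exists_color_subsingleton hUne hcU (by omega)
    refine .of_step hg hU hc hcU hx hv hxv fun c₁ hc₁ hc₁U => ?_
    have h1 := card_filter_ne_add_two_le hU hv
    have h2 := card_filter_ne_add hU hv
    have h3 : 0 < (Finset.univ.filter fun w => g w = g v).card :=
      Finset.card_pos.2 ⟨v, by simp⟩
    have h4 := Finset.card_erase_of_mem hx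
    exact ih _ (by omega) _ _ rfl
      (fun u hu w hw => by
        rw [Finset.mem_filter] at hu ⊢
        exact ⟨hU u hu.1 w hw, hw ▸ hu.2⟩) c₁ hc₁ hc₁U (by omega)

/-- A colouring whose colour classes are the fibres of `g`. -/
def IsBlockColoring (g : V → β) (c : V → α) : Prop := ∀ v w, c v = c w ↔ g v = g w

theorem IsBlockColoring.proper (hg : ∀ u v, G.Adj u v → g u ≠ g v) {c : V → α}
    (hc : IsBlockColoring g c) (u v : V) (huv : G.Adj u v) : c u ≠ c v :=
  fun h => hg u v huv ((hc u v).1 h)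

variable [Fintype α]

theorem exists_blockColoring_of_card (hg : ∀ u v, G.Adj u v → g u ≠ g v) {c : V → α}
    (hc : ∀ u v, G.Adj u v → c u ≠ c v)
    (hcard : Fintype.card V + (singletonFibers g Finset.univ).card + 1 ≤ 2 * Fintype.card α) :
    ∃ c' : V → α, HomConn G (· ≠ ·) c c' ∧ IsBlockColoring g c' := by
  obtain ⟨c', h, -, -, h'⟩ := blockRecolorable_of_card hg _ Finset.univ (Finset.univ : Finset α)
    rfl (by simp) c hc (by simp) hcard
  exact ⟨c', h, by simpa [IsBlockColoring] using h'⟩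

/-- The borderline case, one short of the bound above. A first fibre with three vertices lowers the
left side by 3 and recovers the missing unit. -/
theorem exists_blockColoring_of_card_fiber (hg : ∀ u v, G.Adj u v → g u ≠ g v) {c : V → α}
    (hc : ∀ u v, G.Adj u v → c u ≠ c v)
    (hcard : Fintype.card V + (singletonFibers g Finset.univ).card ≤ 2 * Fintype.card α)
    {x : α} {v : V} (hxv : ∀ w, c w = x → w = v)
    (hv : 3 ≤ (Finset.univ.filter fun w => g w = g v).card) :
    ∃ c' : V → α, HomConn G (· ≠ ·) c c' ∧ IsBlockColoring g c' := by
  have : BlockRecolorable G g Finset.univ (Finset.univ : Finset α) c := by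
    refine .of_step hg (by simp) hc (by simp) (Finset.mem_univ x) (Finset.mem_univ v) hxv
      fun c₁ hc₁ hc₁U => blockRecolorable_of_card hg _ _ _ rfl (fun u hu w hw => ?_) c₁ hc₁ hc₁U ?_
    · rw [Finset.mem_filter] at hu ⊢
      exact ⟨Finset.mem_univ _, hw ▸ hu.2⟩
    · have h1 := card_filter_ne_add (g := g) (U := Finset.univ) (by simp) (Finset.mem_univ v)
      have h2 := Finset.card_le_card (singletonFibers_mono (g := g)
        (Finset.filter_subset (fun w => g w ≠ g v) Finset.univ))
      rw [Finset.card_erase_of_mem (Finset.mem_univ x)]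
      simp only [Finset.card_univ] at *
      omega
  obtain ⟨c', h, -, -, h'⟩ := this
  exact ⟨c', h, by simpa [IsBlockColoring] using h'⟩

/-- Recolouring a fibre of a block colouring by an unused colour. -/
theorem IsBlockColoring.recolor (hg : ∀ u v, G.Adj u v → g u ≠ g v) {c : V → α}
    (hc : IsBlockColoring g c) (v : V) {x : α} (hx : ∀ w, c w ≠ x) :
    ∃ c' : V → α, HomConn G (· ≠ ·) c c' ∧ IsBlockColoring g c' ∧ (∀ w, g w = g v → c' w = x) ∧
      ∀ w, g w ≠ g v → c' w = c w := by
  obtain ⟨c₁, h₁v, h₁⟩ : ∃ c₁ : V → α, (∀ w, g w = g v → c₁ w = x) ∧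
      ∀ w, g w ≠ g v → c₁ w = c w :=
    ⟨fun w => if g w = g v then x else c w, fun w hw => if_pos hw, fun w hw => if_neg hw⟩
  have hc₁ : IsBlockColoring g c₁ := by
    intro u w
    by_cases hu : g u = g v <;> by_cases hw : g w = g v
    · simp [h₁v u hu, h₁v w hw, hu, hw]
    · rw [h₁v u hu, h₁ w hw, hu]
      exact ⟨fun h => absurd h.symm (hx w), fun h => absurd h.symm hw⟩
    · rw [h₁v w hw, h₁ u hu, hw]
      exact ⟨fun h => absurd h (hx u), fun h => absurd h hu⟩
    · rw [h₁ u hu, h₁ w hw]; exact hc u w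
  refine ⟨c₁, .single fun u w huw => ⟨hc.proper hg u w huw, hc₁.proper hg u w huw, ?_⟩, hc₁, h₁v,
    h₁⟩
  by_cases hw : g w = g v
  · rw [h₁v w hw]; exact hx u
  · rw [h₁ w hw]; exact hc.proper hg u w huw

theorem IsBlockColoring.exists_unused {c : V → α} (hc : IsBlockColoring g c)
    (hcard : (Finset.univ.image g).card < Fintype.card α) : ∃ x, ∀ w, c w ≠ x := by
  by_contra! h
  have hs : (Finset.univ.image c) = Finset.univ := by
    ext x
    simpa using h x
  have : Fintype.card α ≤ (Finset.univ.image g).card := by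
    choose s hs using h
    refine Finset.card_le_card_of_injOn (s := Finset.univ) (fun x => g (s x)) (by simp) ?_
    intro x _ y _ hxy
    rw [← hs x, ← hs y]
    exact (hc _ _).2 hxy
  omega

/-- If there is a spare colour, all colourings with given colour classes are connected. -/
theorem IsBlockColoring.homConn (hg : ∀ u v, G.Adj u v → g u ≠ g v)
    (hcard : (Finset.univ.image g).card < Fintype.card α) {c₀ : V → α}
    (hc₀ : IsBlockColoring g c₀) (n : ℕ) :
    ∀ c : V → α, IsBlockColoring g c → (Finset.univ.filter fun v => c v ≠ c₀ v).card = n →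
      HomConn G (· ≠ ·) c c₀ := by
  induction n using Nat.strong_induction_on with
  | _ n ih =>
    intro c hc hn
    by_cases hcc : c = c₀
    · rw [hcc]
    obtain ⟨v, hv⟩ := Function.ne_iff.1 hcc
    have key : ∀ c : V → α, IsBlockColoring g c → c v ≠ c₀ v → (∀ w, c w ≠ c₀ v) →
        (Finset.univ.filter fun v => c v ≠ c₀ v).card ≤ n → HomConn G (· ≠ ·) c c₀ := by
      intro c hc hv hfree hle
      obtain ⟨c', h1, h2, h3, h4⟩ := hc.recolor hg v hfree
      refine h1.trans (ih _ (lt_of_lt_of_le (Finset.card_lt_card ?_) hle) c' h2 rfl)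
      refine (Finset.ssubset_iff_of_subset fun w hw => ?_).2 ⟨v, by simpa using hv, by simp [h3]⟩
      simp only [Finset.mem_filter, Finset.mem_univ, true_and] at hw ⊢
      by_cases hwv : g w = g v
      · exact absurd ((h3 w hwv).trans ((hc₀ v w).2 hwv.symm)) hw
      · rwa [h4 w hwv] at hw
    -- If the target colour `c₀ v` is occupied, its block is first parked on the spare colour. That
    -- block was wrongly coloured anyway, so the number of disagreements does not grow.
    by_cases hfree : ∀ w, c w ≠ c₀ v
    · exact key c hc hv hfree hn.le
    push Not at hfree
    obtain ⟨u, hu⟩ := hfree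
    obtain ⟨x, hx⟩ := hc.exists_unused hcard
    obtain ⟨c', h1, h2, h3, h4⟩ := hc.recolor hg u hx
    have hxv : x ≠ c₀ v := fun h => hx u (hu.trans h.symm)
    have huv : g v ≠ g u := fun h => hv (((hc v u).2 h).trans hu)
    refine h1.trans (key c' h2 ?_ ?_ ?_)
    · rwa [h4 v huv]
    · intro w
      by_cases hw : g w = g u
      · rwa [h3 w hw]
      · rw [h4 w hw, ← hu]
        exact fun h => hw ((hc w u).1 h)
    · rw [← hn]
      refine Finset.card_le_card fun w hw => ?_
      simp only [Finset.mem_filter, Finset.mem_univ, true_and] at hw ⊢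
      by_cases hwu : g w = g u
      · rw [(hc w u).2 hwu, hu]
        exact fun h => huv (((hc₀ v w).1 h).trans hwu)
      · rwa [h4 w hwu] at hw

end Blocks

/-! ### Connectedness of the proper `M`-colourings of a circular clique. -/

section Cliques

variable {k q M : ℕ}

theorem circularClique_adj_of_lt {i j : Fin k} (h : (i : ℕ) < j) :
    (circularClique k q).Adj i j ↔ (i : ℕ) + q ≤ j ∧ (j : ℕ) + q ≤ i + k := by
  have hne : i ≠ j := fun e => by rw [e] at h; exact lt_irrefl _ h
  have habs : |((i : ℕ) : ℤ) - ((j : ℕ) : ℤ)| = (j : ℕ) - (i : ℕ) := by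
    rw [abs_sub_comm, abs_of_nonneg (by omega)]
  simp only [circularClique, habs]
  constructor
  · rintro ⟨-, h1, h2⟩; constructor <;> omega
  · rintro ⟨h1, h2⟩; exact ⟨hne, by omega, by omega⟩

theorem circularClique_adj_cases {i j : Fin k} (h : (circularClique k q).Adj i j) :
    ((i : ℕ) + q ≤ j ∧ (j : ℕ) + q ≤ i + k) ∨ ((j : ℕ) + q ≤ i ∧ (i : ℕ) + q ≤ j + k) := by
  rcases lt_trichotomy (i : ℕ) j with hlt | heq | hgt
  · exact .inl ((circularClique_adj_of_lt hlt).1 h)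
  · exact absurd (Fin.ext heq) h.ne
  · exact .inr ((circularClique_adj_of_lt hgt).1 h.symm)

/-- Blocks of vertices spanning less than `q` are independent in `G_{k,q}`. -/
theorem proper_of_fiber_lt {g : Fin k → ℕ} (hg : ∀ i j, g i = g j → (j : ℕ) < i + q)
    (i j : Fin k) (h : (circularClique k q).Adj i j) : g i ≠ g j := by
  intro he
  have h1 := hg i j he
  have h2 := hg j i he.symm
  rcases circularClique_adj_cases h with h | h <;> omega

theorem card_singletonFibers_eq_zero {V β : Type*} [Fintype V] [DecidableEq V] [DecidableEq β]
    {g : V → β} (h : ∀ v, ∃ w, g w = g v ∧ w ≠ v) :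
    (singletonFibers g Finset.univ).card = 0 := by
  rw [Finset.card_eq_zero, Finset.eq_empty_iff_forall_notMem]
  intro v hv
  obtain ⟨w, hw, hne⟩ := h v
  exact hne ((mem_singletonFibers.1 hv).2 w hw)

theorem homConn_of_isBlockColoring {g : Fin k → ℕ}
    (hg : ∀ u v, (circularClique k q).Adj u v → g u ≠ g v) (hM : 0 < M) (hgM : ∀ v, g v + 1 < M)
    {c : Fin k → Fin M} (hc : IsBlockColoring g c) :
    HomConn (circularClique k q) (· ≠ ·) c
      (fun v => (⟨g v, (Nat.lt_succ_self _).trans (hgM v)⟩ : Fin M)) := by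
  refine IsBlockColoring.homConn hg ?_ (fun v w => by simp [Fin.ext_iff]) _ c hc rfl
  have hsub : Finset.univ.image g ⊆ Finset.range (M - 1) := by
    intro x hx
    obtain ⟨w, -, rfl⟩ := Finset.mem_image.1 hx
    have := hgM w
    simp; omega
  have := Finset.card_le_card hsub
  simp only [Finset.card_range, Fintype.card_fin] at *
  omega

theorem homConn_blocks {g : Fin k → ℕ} (hg : ∀ u v, (circularClique k q).Adj u v → g u ≠ g v)
    (hM : 0 < M) (hgM : ∀ v, g v + 1 < M) (hs : k + (singletonFibers g Finset.univ).card + 1 ≤ 2 * M)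
    {c : Fin k → Fin M} (hc : ∀ u v, (circularClique k q).Adj u v → c u ≠ c v) :
    HomConn (circularClique k q) (· ≠ ·) c
      (fun v => (⟨g v, (Nat.lt_succ_self _).trans (hgM v)⟩ : Fin M)) := by
  obtain ⟨c', h1, h2⟩ := exists_blockColoring_of_card hg hc (by simpa using hs)
  exact h1.trans (homConn_of_isBlockColoring hg hM hgM h2)

/-- The partition of `{0, …, k - 1}` into pairs of consecutive elements, except for two triples of
consecutive elements that start at `a`. -/
def tripleBlocks (k a : ℕ) (i : Fin k) : ℕ :=
  if (i : ℕ) < a then i / 2 else if (i : ℕ) < a + 3 then a / 2 else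
    if (i : ℕ) < a + 6 then a / 2 + 1 else i / 2 - 1

variable {a : ℕ}

theorem tripleBlocks_proper (hq : 3 ≤ q) (ha : Even a) (i j : Fin k)
    (h : (circularClique k q).Adj i j) : tripleBlocks k a i ≠ tripleBlocks k a j := by
  refine proper_of_fiber_lt (fun i j he => ?_) i j h
  obtain ⟨b, rfl⟩ := ha
  simp only [tripleBlocks] at he
  split_ifs at he <;> omega

theorem tripleBlocks_lt (ha : Even a) (hk : Even k) (hak : a + 6 ≤ k) (hM : k ≤ 2 * M)
    (i : Fin k) : tripleBlocks k a i + 1 < M := by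
  obtain ⟨b, rfl⟩ := ha
  obtain ⟨l, rfl⟩ := hk
  have := i.2
  simp only [tripleBlocks]
  split_ifs <;> omega

theorem tripleBlocks_partner (ha : Even a) (hk : Even k) (hak : a + 6 ≤ k) (i : Fin k) :
    ∃ j, tripleBlocks k a j = tripleBlocks k a i ∧ j ≠ i := by
  obtain ⟨b, rfl⟩ := ha
  obtain ⟨l, rfl⟩ := hk
  have hi := i.2
  have key : ∀ j (hj : j < l + l), tripleBlocks (l + l) (b + b) ⟨j, hj⟩ =
      tripleBlocks (l + l) (b + b) i ∧ j ≠ i →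
      ∃ j, tripleBlocks (l + l) (b + b) j = tripleBlocks (l + l) (b + b) i ∧ j ≠ i :=
    fun j hj h => ⟨⟨j, hj⟩, h.1, fun e => h.2 (by rw [← e])⟩
  by_cases h1 : (b + b ≤ (i : ℕ) ∧ (i : ℕ) < b + b + 6)
  · by_cases h2 : (i : ℕ) = b + b + 2 ∨ (i : ℕ) = b + b + 5
    · refine key (i - 1) (by omega) ⟨?_, by omega⟩
      simp only [tripleBlocks]
      split_ifs <;> omega
    · refine key (i + 1) (by omega) ⟨?_, by omega⟩
      simp only [tripleBlocks]
      split_ifs <;> omega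
  · by_cases h2 : (i : ℕ) % 2 = 0
    · refine key (i + 1) (by omega) ⟨?_, by omega⟩
      simp only [tripleBlocks]
      split_ifs <;> omega
    · refine key (i - 1) (by omega) ⟨?_, by omega⟩
      simp only [tripleBlocks]
      split_ifs <;> omega

theorem three_le_card_tripleBlocks (hak : a + 6 ≤ k) (i : Fin k) (hi : a ≤ i)
    (hi' : (i : ℕ) < a + 6) :
    3 ≤ (Finset.univ.filter fun j => tripleBlocks k a j = tripleBlocks k a i).card := by
  obtain ⟨b, hb1, hb3⟩ : ∃ b, b + 3 ≤ k ∧ ∀ j : Fin k, b ≤ j → (j : ℕ) < b + 3 →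
      tripleBlocks k a j = tripleBlocks k a i := by
    by_cases h : (i : ℕ) < a + 3
    · refine ⟨a, by omega, fun j h1 h2 => ?_⟩
      simp only [tripleBlocks]
      split_ifs <;> omega
    · refine ⟨a + 3, by omega, fun j h1 h2 => ?_⟩
      simp only [tripleBlocks]
      split_ifs <;> omega
  refine Finset.two_lt_card.2 ⟨⟨b, by omega⟩, ?_, ⟨b + 1, by omega⟩, ?_, ⟨b + 2, by omega⟩, ?_, ?_⟩
  · simpa using hb3 ⟨b, by omega⟩ (by simp) (by simp)
  · simpa using hb3 ⟨b + 1, by omega⟩ (by simp) (by simp)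
  · simpa using hb3 ⟨b + 2, by omega⟩ (by simp) (by simp)
  · simp [Fin.ext_iff]

/-- A colouring of a circular clique with at least half as many colours as vertices can be
recoloured so that some colour is used at most once. -/
theorem exists_homConn_color_subsingleton (hq : 3 ≤ q) (hkq : 2 * q ≤ k) (hM : k ≤ 2 * M)
    {c : Fin k → Fin M} (hc : ∀ u v, (circularClique k q).Adj u v → c u ≠ c v) :
    ∃ c' : Fin k → Fin M, HomConn (circularClique k q) (· ≠ ·) c c' ∧
      (∀ u v, (circularClique k q).Adj u v → c' u ≠ c' v) ∧
      ∃ x v, ∀ w, c' w = x → w = v := by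
  have hk0 : 0 < k := by omega
  by_cases hsmall : ∃ x, (Finset.univ.filter fun v => c v = x).card ≤ 1
  · obtain ⟨x, hx⟩ := hsmall
    have : Nonempty (Fin k) := ⟨⟨0, hk0⟩⟩
    obtain ⟨v, hv⟩ := Finset.card_le_one_iff_subset_singleton.1 hx
    exact ⟨c, .refl, hc, x, v, fun w hw => by
      simpa using hv (Finset.mem_filter.2 ⟨Finset.mem_univ w, hw⟩)⟩
  push Not at hsmall
  -- With every colour used at least twice, `k ≤ 2 * M` forces each to be used exactly twice.
  have hall : ∀ x, (Finset.univ.filter fun v => c v = x).card = 2 := by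
    have hsum := Finset.card_eq_sum_card_fiberwise (f := c) (s := Finset.univ) (t := Finset.univ)
      (by simp)
    have hle : ∀ x ∈ (Finset.univ : Finset (Fin M)),
        2 ≤ (Finset.univ.filter fun v => c v = x).card := fun x _ => hsmall x
    have h2 := Finset.card_nsmul_le_sum _ _ _ hle
    have heq : ∑ x : Fin M, 2 = ∑ x : Fin M, (Finset.univ.filter fun v => c v = x).card := by
      simp only [Finset.card_univ, Fintype.card_fin, smul_eq_mul] at hsum h2
      simp only [Finset.sum_const, Finset.card_univ, Fintype.card_fin, smul_eq_mul]
      omega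
    intro x
    exact ((Finset.sum_eq_sum_iff_of_le hle).1 heq x (Finset.mem_univ x)).symm
  obtain ⟨z, hz⟩ : ∃ z : Fin k, (z : ℕ) = 0 := ⟨⟨0, hk0⟩, rfl⟩
  have hother : ∀ v, ∃ v', v' ≠ v ∧ ∀ w, c w = c v ↔ w = v ∨ w = v' := by
    intro v
    obtain ⟨a, b, hab, h⟩ := Finset.card_eq_two.1 (hall (c v))
    have hmem : ∀ w, c w = c v ↔ w = a ∨ w = b := fun w => by
      have := Finset.ext_iff.1 h w
      simpa using this
    rcases (hmem v).1 rfl with rfl | rfl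
    · exact ⟨b, hab.symm, hmem⟩
    · exact ⟨a, hab, fun w => (hmem w).trans or_comm⟩
  obtain ⟨y, hyz, hy⟩ := hother z
  have hyz0 : (y : ℕ) ≠ 0 := fun h => hyz (Fin.ext (h.trans hz.symm))
  have hnadj : ¬ (circularClique k q).Adj z y := fun h => hc _ _ h ((hy y).2 (.inr rfl)).symm
  rw [circularClique_adj_of_lt (by omega)] at hnadj
  -- A vertex `w` nonadjacent to both members of the class `{z, y}` can join it, so the old colour
  -- of `w` keeps only one vertex. Such a `w` exists because `q ≥ 3`.
  obtain ⟨w, hwz, hwy, hwz', hwy'⟩ : ∃ w : Fin k, w ≠ z ∧ w ≠ y ∧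
      ¬ (circularClique k q).Adj w z ∧ ¬ (circularClique k q).Adj w y := by
    have key : ∀ w (hw : w < k), w ≠ 0 → w ≠ y → (w < q ∨ k < w + q) →
        ((w < y ∧ (y < w + q ∨ w + k < y + q)) ∨ (y < w ∧ (w < y + q ∨ y + k < w + q))) →
        ∃ w : Fin k, w ≠ z ∧ w ≠ y ∧
          ¬ (circularClique k q).Adj w z ∧ ¬ (circularClique k q).Adj w y := by
      intro w hw h1 h2 h3 h4
      refine ⟨⟨w, hw⟩, fun h => h1 (by rw [← hz, ← h]), fun h => h2 (by rw [← h]), fun h => ?_,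
        fun h => ?_⟩
      · rcases circularClique_adj_cases h with h | h <;> simp only at h <;> omega
      · rcases circularClique_adj_cases h with h | h <;> simp only at h <;> omega
    have := y.2
    by_cases hy1 : (y : ℕ) = 1
    · exact key 2 (by omega) (by omega) (by omega) (by omega) (by omega)
    by_cases hy2 : (y : ℕ) < q
    · exact key 1 (by omega) (by omega) (by omega) (by omega) (by omega)
    by_cases hy3 : (y : ℕ) + 1 = k
    · exact key 1 (by omega) (by omega) (by omega) (by omega) (by omega)
    · exact key (y + 1) (by omega) (by omega) (by omega) (by omega) (by omega)
  obtain ⟨w', hw', hww'⟩ := hother w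
  obtain ⟨c₁, h₁w, h₁⟩ : ∃ c₁ : Fin k → Fin M, c₁ w = c z ∧ ∀ u, u ≠ w → c₁ u = c u :=
    ⟨fun u => if u = w then c z else c u, if_pos rfl, fun u hu => if_neg hu⟩
  have hcw : ∀ u, (circularClique k q).Adj w u → c u ≠ c z := by
    intro u hu h
    rcases (hy u).1 h with rfl | rfl
    · exact hwz' hu
    · exact hwy' hu
  have hstep : ∀ u v, (circularClique k q).Adj u v → c₁ u ≠ c₁ v ∧ c u ≠ c₁ v := by
    intro u v huv
    by_cases hu : u = w
    · subst hu
      rw [h₁w, h₁ v huv.ne.symm]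
      exact ⟨(hcw v huv).symm, hc _ _ huv⟩
    · by_cases hv : v = w
      · subst hv
        rw [h₁w, h₁ u hu]
        exact ⟨hcw u huv.symm, hcw u huv.symm⟩
      · rw [h₁ u hu, h₁ v hv]
        exact ⟨hc _ _ huv, hc _ _ huv⟩
  refine ⟨c₁, .single fun u v huv => ⟨hc u v huv, hstep u v huv⟩, fun u v huv => (hstep u v huv).1,
    c w, w', fun u hu => ?_⟩
  by_cases huw : u = w
  · rw [huw, h₁w] at hu
    rcases (hy w).1 hu.symm with h | h
    · exact absurd h hwz
    · exact absurd h hwy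
  · rw [h₁ u huw] at hu
    exact ((hww' u).1 hu).resolve_left huw

/-- When `k = 2M` the counting bound just fails, so a triple must be created first. Its position `a`
is dictated by the vertex of the rarely used colour; the two triples leave a colour unused, and with
it the triples can be moved to `a = 0`. -/
theorem homConn_tripleBlocks (hq : 3 ≤ q) (hkq : 2 * q ≤ k) (hk : Even k) (hM : k ≤ 2 * M)
    (c : Fin k → Fin M) (hc : ∀ u v, (circularClique k q).Adj u v → c u ≠ c v) :
    HomConn (circularClique k q) (· ≠ ·) c
      (fun v => (⟨tripleBlocks k 0 v, (Nat.lt_succ_self _).trans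
        (tripleBlocks_lt .zero hk (by omega) hM v)⟩ : Fin M)) := by
  have hs : ∀ {a}, Even a → a + 6 ≤ k →
      Fintype.card (Fin k) + (singletonFibers (tripleBlocks k a) Finset.univ).card ≤
        2 * Fintype.card (Fin M) := by
    intro a ha hak
    rw [card_singletonFibers_eq_zero (tripleBlocks_partner ha hk hak)]
    simpa using hM
  obtain ⟨c₁, hcc₁, hc₁, x, v, hxv⟩ := exists_homConn_color_subsingleton hq hkq hM hc
  obtain ⟨a, ha, hak, hav, hva⟩ : ∃ a, Even a ∧ a + 6 ≤ k ∧ a ≤ (v : ℕ) ∧ (v : ℕ) < a + 6 := by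
    have := v.2
    obtain ⟨l, rfl⟩ := hk
    by_cases h : (v : ℕ) + 6 ≤ l + l
    · exact ⟨2 * (v / 2), by simp, by omega, by omega, by omega⟩
    · exact ⟨l + l - 6, ⟨l - 3, by omega⟩, by omega, by omega, by omega⟩
  obtain ⟨c₂, hcc₂, hc₂⟩ := exists_blockColoring_of_card_fiber (tripleBlocks_proper hq ha) hc₁
    (hs ha hak) hxv (three_le_card_tripleBlocks hak v hav hva)
  have hM0 : 0 < M := by omega
  obtain ⟨x', hx'⟩ := hc₂.exists_unused (by
    have hsub : Finset.univ.image (tripleBlocks k a) ⊆ Finset.range (M - 1) := by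
      intro x hx
      obtain ⟨w, -, rfl⟩ := Finset.mem_image.1 hx
      have := tripleBlocks_lt ha hk hak hM w
      simp; omega
    have := Finset.card_le_card hsub
    simp only [Finset.card_range, Fintype.card_fin] at *
    omega)
  obtain ⟨c₃, hcc₃, hc₃⟩ := exists_blockColoring_of_card_fiber (tripleBlocks_proper hq .zero)
    (hc₂.proper (tripleBlocks_proper hq ha)) (hs .zero (by omega)) (v := ⟨0, by omega⟩)
    (fun w hw => absurd hw (hx' w)) (three_le_card_tripleBlocks (by omega) _ (by simp) (by simp))
  exact hcc₁.trans (hcc₂.trans (hcc₃.trans (homConn_of_isBlockColoring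
    (tripleBlocks_proper hq .zero) hM0 (tripleBlocks_lt .zero hk (by omega) hM) hc₃)))

/-- All proper colourings of a circular clique with sufficiently many colours are connected to a
single one, which does not use the last colour. -/
theorem exists_homConn_circularClique (hq0 : 0 < q) (hkq : 2 * q ≤ k) (hcop : Nat.gcd k q = 1)
    (hM : k ≤ 2 * M) (hM1 : q = 1 → k + 1 ≤ M) (hM2 : q = 2 → k + 3 ≤ 2 * M) :
    ∃ c₀ : Fin k → Fin M, (∀ v, (c₀ v : ℕ) + 1 < M) ∧
      (∀ u v, (circularClique k q).Adj u v → c₀ u ≠ c₀ v) ∧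
      ∀ c : Fin k → Fin M, (∀ u v, (circularClique k q).Adj u v → c u ≠ c v) →
        HomConn (circularClique k q) (· ≠ ·) c c₀ := by
  have hM0 : 0 < M := by omega
  have main : ∀ g : Fin k → ℕ, (∀ u v, (circularClique k q).Adj u v → g u ≠ g v) →
      (∀ v, g v + 1 < M) → k + (singletonFibers g Finset.univ).card + 1 ≤ 2 * M →
      ∃ c₀ : Fin k → Fin M, (∀ v, (c₀ v : ℕ) + 1 < M) ∧
      (∀ u v, (circularClique k q).Adj u v → c₀ u ≠ c₀ v) ∧
      ∀ c : Fin k → Fin M, (∀ u v, (circularClique k q).Adj u v → c u ≠ c v) →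
        HomConn (circularClique k q) (· ≠ ·) c c₀ := fun g hg hgM hs =>
    ⟨fun v => ⟨g v, (Nat.lt_succ_self _).trans (hgM v)⟩, hgM,
      fun u v huv h => hg u v huv (Fin.ext_iff.1 h),
      fun c hc => homConn_blocks hg hM0 hgM hs hc⟩
  obtain rfl | rfl | hq3 : q = 1 ∨ q = 2 ∨ 3 ≤ q := by omega
  · have hM1 := hM1 rfl
    refine main (fun v => v) (proper_of_fiber_lt fun i j h => by omega)
      (fun v => by have := v.2; omega) ?_
    have := Finset.card_le_univ (singletonFibers (fun v : Fin k => (v : ℕ)) Finset.univ)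
    rw [Fintype.card_fin] at this
    omega
  · have hM2 := hM2 rfl
    have hodd : k % 2 = 1 := by
      by_contra h
      have : (2 : ℕ) ∣ Nat.gcd k 2 := Nat.dvd_gcd (by omega) dvd_rfl
      rw [hcop] at this
      omega
    refine main (fun v => v / 2) (proper_of_fiber_lt fun i j h => by omega)
      (fun v => by have := v.2; omega) ?_
    have : (singletonFibers (fun v : Fin k => (v : ℕ) / 2) Finset.univ).card ≤ 1 := by
      have hlast : ∀ v ∈ singletonFibers (fun v : Fin k => (v : ℕ) / 2) Finset.univ,
          (v : ℕ) + 1 = k := by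
        intro v hv
        have hv := (mem_singletonFibers.1 hv).2
        by_contra h
        have := v.2
        by_cases h2 : (v : ℕ) % 2 = 0
        · have := hv ⟨v + 1, by omega⟩ (by simp only; omega)
          simp [Fin.ext_iff] at this
        · have := hv ⟨v - 1, by omega⟩ (by simp only; omega)
          simp only [Fin.ext_iff] at this
          omega
      refine Finset.card_le_one.2 fun u hu v hv => Fin.ext ?_
      have := hlast u hu; have := hlast v hv
      omega
    omega
  · rcases Nat.even_or_odd k with hk | hk
    · exact ⟨_, fun v => tripleBlocks_lt .zero hk (by omega) hM v,
        fun u v huv h => tripleBlocks_proper hq3 .zero u v huv (Fin.ext_iff.1 h),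
        fun c hc => homConn_tripleBlocks hq3 hkq hk hM c hc⟩
    · obtain ⟨b, rfl⟩ := hk
      -- Pairs, except that the last block is the triple `{2b - 2, 2b - 1, 2b}`; there are no
      -- singletons.
      refine main (fun v => min ((v : ℕ) / 2) (b - 1)) (proper_of_fiber_lt fun i j h => ?_)
        (fun v => ?_) ?_
      · have := i.2; have := j.2; omega
      · omega
      · rw [card_singletonFibers_eq_zero fun v => ?_]
        · omega
        have := v.2
        by_cases h : (v : ℕ) % 2 = 0 ∧ (v : ℕ) < 2 * b
        · exact ⟨⟨v + 1, by omega⟩, by simp only; omega, by simp [Fin.ext_iff]⟩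
        · refine ⟨⟨v - 1, by omega⟩, by simp only; omega, ?_⟩
          rw [Ne, Fin.ext_iff]
          simp only
          omega

end Cliques

/-! ### Connectedness of all circular colourings of a circular clique. -/

section Mixing

variable {p r : ℤ}

theorem not_circAdj_self (hr : 0 < r) (hp : 0 < p) (x : ℤ) : ¬ CircAdj p r x x := by
  rintro ⟨n, h1, h2⟩
  rw [sub_self, zero_add] at h1 h2
  have h3 : 0 < n := by
    by_contra! h
    nlinarith
  nlinarith

/-- With colours in `[0, p - r - 1]` there is room to move everything up by 1, highest colours
first; iterating gives any rotation. -/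
theorem homConn_rotate {V : Type*} {G : SimpleGraph V} {f : V → ℤ} (hr : 0 < r)
    (hf : ∀ u v, G.Adj u v → CircAdj p r (f u) (f v)) (h0 : ∀ v, 0 ≤ f v)
    (h1 : ∀ v, f v + 1 ≤ p - r) (b : ℤ) : HomConn G (CircAdj p r) (fun v => b + f v) f := by
  have hstep : HomConn G (CircAdj p r) f (fun v => 1 + f v) := by
    refine HomConn.of_rank CircAdj.symm (fun v => (p - f v).toNat) (p.toNat + 1) (fun v => ?_) hf
      (fun u v huv => (hf u v huv).add 1) fun u v huv hσ => ?_
    · have := h0 v; omega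
    · have := h0 u; have := h1 u; have := h0 v; have := h1 v
      have := (hf u v huv).bounds hr (by linarith) (by linarith)
      exact circAdj_of_gt (by omega) (by omega)
  have hb : ∀ b : ℤ, HomConn G (CircAdj p r) (fun v => b + f v) (fun v => b + 1 + f v) := by
    intro b
    simpa only [← add_assoc] using hstep.map (S := CircAdj p r) (fun x => b + x) fun _ _ h => h.add b
  induction b using Int.induction_on with
  | zero => simpa using Relation.ReflTransGen.refl
  | succ n ih => exact ((hb n).symm CircAdj.symm).trans ih
  | pred n ih =>
    have := hb (-n - 1)
    rw [sub_add_cancel] at this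
    exact this.trans ih

/-- All colourings of a circular clique in sufficiently many circular colours are connected. -/
theorem exists_forall_homConn {k q M : ℕ} (hq0 : 0 < q) (hkq : 2 * q ≤ k)
    (hcop : Nat.gcd k q = 1) (hr : 0 < r) (hMp : r * M ≤ p) (hpM : p < r * (M + 1))
    (hp : r * (k + 1) ≤ 2 * p) (hM1 : q = 1 → k + 1 ≤ M) (hM2 : q = 2 → k + 3 ≤ 2 * M) :
    ∃ h₀ : Fin k → ℤ, (∀ u v, (circularClique k q).Adj u v → CircAdj p r (h₀ u) (h₀ v)) ∧
      ∀ f : Fin k → ℤ, (∀ u v, (circularClique k q).Adj u v → CircAdj p r (f u) (f v)) →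
        HomConn (circularClique k q) (CircAdj p r) f h₀ := by
  have hkM : k ≤ 2 * M := by
    have : (k : ℤ) + 1 < 2 * (M + 1) := by
      by_contra! h
      nlinarith
    omega
  have hM0 : (1 : ℤ) ≤ M := by omega
  have hrp : r ≤ p := by nlinarith
  obtain ⟨c₀, hc₀M, hc₀, hconn⟩ := exists_homConn_circularClique hq0 hkq hcop hkM hM1 hM2
  have hcirc : ∀ b (i j : Fin M), i ≠ j → CircAdj p r (b + r * (i : ℕ)) (b + r * (j : ℕ)) := by
    intro b i j hij
    have hlt : ∀ i j : Fin M, (i : ℕ) < j → CircAdj p r (b + r * (i : ℕ)) (b + r * (j : ℕ)) := by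
      intro i j h
      have h1 : ((i : ℕ) : ℤ) + 1 ≤ (j : ℕ) := by exact_mod_cast h
      have h2 : ((j : ℕ) : ℤ) + 1 ≤ M := by exact_mod_cast j.2
      have h3 : (0 : ℤ) ≤ (i : ℕ) := by positivity
      exact circAdj_of_lt (by nlinarith) (by nlinarith)
    rcases lt_or_gt_of_ne (fun e => hij (Fin.ext e) : (i : ℕ) ≠ j) with h | h
    · exact hlt i j h
    · exact (hlt j i h).symm
  have hhom₀ : ∀ u v, (circularClique k q).Adj u v →
      CircAdj p r (r * ((c₀ u : ℕ) : ℤ)) (r * ((c₀ v : ℕ) : ℤ)) := fun u v huv => by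
    simpa using hcirc 0 _ _ (hc₀ u v huv)
  refine ⟨fun v => r * ((c₀ v : ℕ) : ℤ), hhom₀, fun f hf => ?_⟩
  obtain ⟨b, f', hff', hf'⟩ := exists_homConn_compressed hr hrp (by simpa using hp) hf
  have hf'hom : ∀ u v, (circularClique k q).Adj u v → CircAdj p r (f' u) (f' v) := fun u v huv => by
    simpa using (hff'.isHom hf u v huv).add (-b)
  have hfloor := homConn_floor hr hf'hom (fun v => (hf' v).1) (fun v => (hf' v).2)
  have hd0 : ∀ v, 0 ≤ f' v / r := fun v => Int.ediv_nonneg (hf' v).1 hr.le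
  have hdM : ∀ v, f' v / r < M := fun v =>
    Int.ediv_lt_of_lt_mul hr (by have := (hf' v).2; linarith)
  obtain ⟨c, hc⟩ : ∃ c : Fin k → Fin M, ∀ v, ((c v : ℕ) : ℤ) = f' v / r :=
    ⟨fun v => ⟨(f' v / r).toNat, by have := hd0 v; have := hdM v; omega⟩,
      fun v => Int.toNat_of_nonneg (hd0 v)⟩
  have hcproper : ∀ u v, (circularClique k q).Adj u v → c u ≠ c v := by
    intro u v huv h
    have h1 := hfloor.isHom hf'hom u v huv
    simp only [← hc, h] at h1
    exact not_circAdj_self hr (hr.trans_le hrp) _ h1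
  have h2 := (hconn c hcproper).map (S := CircAdj p r) (fun i : Fin M => b + r * ((i : ℕ) : ℤ)) (hcirc b)
  have h3 := hfloor.map (S := CircAdj p r) (fun x => b + x) fun _ _ h => h.add b
  simp only [hc] at h2
  refine hff'.trans (h3.trans (h2.trans (homConn_rotate hr hhom₀ (fun v => by positivity)
    (fun v => ?_) b)))
  have h4 : ((c₀ v : ℕ) : ℤ) + 1 + 1 ≤ M := by exact_mod_cast hc₀M v
  nlinarith

end Mixing

/-! ### Circular cliques with coprime parameters are cores. -/

section Core

variable {k q : ℕ}

theorem card_le_of_independent (hkq : 2 * q ≤ k) {I : Finset (Fin k)}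
    (hI : ∀ u ∈ I, ∀ v ∈ I, ¬ (circularClique k q).Adj u v) (hq : 0 < q) : I.card ≤ q := by
  rcases I.eq_empty_or_nonempty with rfl | ⟨x, hx⟩
  · simp
  have hI' : ∀ u ∈ I, ∀ v ∈ I, (u : ℕ) < v → (v : ℕ) < u + q ∨ u + k < v + q := by
    intro u hu v hv huv
    have := hI u hu v hv
    rw [circularClique_adj_of_lt huv] at this
    omega
  -- The other members of `I` lie within `q - 1` of `x` cyclically. Here `φ` identifies `x + t` with
  -- `x + t - q`; these are adjacent, so at most one of them is in `I`.
  let φ : Fin k → ℕ := fun y =>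
    if x ≤ (y : ℕ) then (if (y : ℕ) < x + q then y - x else y + q - x - k)
    else (if y + k < (x : ℕ) + q then y + k - x else y + q - x)
  rw [← Finset.card_range q]
  refine Finset.card_le_card_of_injOn φ (fun y hy => ?_) (fun y hy z hz hyz => Fin.ext ?_)
  · have h1 := hI' x hx y hy; have h2 := hI' y hy x hx
    have := y.2; have := x.2
    simp only [Finset.coe_range, Set.mem_Iio, φ]
    split_ifs <;> omega
  · have h1 := hI' x hx y hy; have h2 := hI' y hy x hx
    have h3 := hI' x hx z hz; have h4 := hI' z hz x hx
    have h5 := hI' y hy z hz; have h6 := hI' z hz y hy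
    have := y.2; have := x.2; have := z.2
    simp only [φ] at hyz
    split_ifs at hyz <;> omega

/-- A circular clique `G_{k,q}` with `k` and `q` coprime is a core. -/
theorem circularClique_endo_bijective (hq : 0 < q) (hkq : 2 * q ≤ k) (hcop : Nat.gcd k q = 1)
    (e : circularClique k q →g circularClique k q) : Function.Bijective e := by
  have hk0 : 0 < k := by omega
  have : NeZero k := ⟨hk0.ne'⟩
  let n : ZMod k → ℕ := fun x => (Finset.univ.filter fun v => ((e v : ℕ) : ZMod k) = x).card
  -- `S x` counts the preimage of `q` consecutive vertices. That preimage is independent, so `S x ≤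
  -- q`, while the average of `S` is `q`; hence `S` is constant. Comparing `S x` with `S (x + 1)`
  -- gives `n (x + q) = n x`, and `q` generates `ZMod k`.
  let S : ZMod k → ℕ := fun x => ∑ i ∈ Finset.range q, n (x + (i : ℕ))
  have hn : ∑ x, n x = k := by
    have := Finset.card_eq_sum_card_fiberwise (f := fun v => ((e v : ℕ) : ZMod k))
      (s := Finset.univ) (t := Finset.univ) (by simp)
    rw [Finset.card_univ, Fintype.card_fin] at this
    exact this.symm
  have hSle : ∀ x, S x ≤ q := by
    intro x
    have hcast : ∀ (v w : Fin k) (i j : ℕ), ((e v : ℕ) : ZMod k) = x + (i : ℕ) →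
        ((e w : ℕ) : ZMod k) = x + (j : ℕ) → (k : ℤ) ∣ (e v : ℕ) + j - ((e w : ℕ) + i) := by
      intro v w i j hv hw
      rw [← ZMod.intCast_zmod_eq_zero_iff_dvd]
      push_cast
      rw [hv, hw]
      ring
    have hS : S x = ((Finset.range q).biUnion fun i : ℕ =>
        Finset.univ.filter fun v => ((e v : ℕ) : ZMod k) = x + (i : ℕ)).card := by
      rw [Finset.card_biUnion]
      intro i hi j hj hij
      rw [Function.onFun, Finset.disjoint_left]
      intro v hv hv'
      simp only [Finset.mem_filter, Finset.mem_univ, true_and] at hv hv'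
      rw [Finset.mem_coe, Finset.mem_range] at hi hj
      have := Int.eq_zero_of_abs_lt_dvd (hcast v v i j hv hv') (by rw [abs_lt]; omega)
      omega
    rw [hS]
    refine card_le_of_independent hkq (fun u hu v hv huv => ?_) hq
    simp only [Finset.mem_biUnion, Finset.mem_range, Finset.mem_filter, Finset.mem_univ,
      true_and] at hu hv
    obtain ⟨i, hi, hu⟩ := hu
    obtain ⟨j, hj, hv⟩ := hv
    have h1 := hcast u v i j hu hv
    rcases circularClique_adj_cases (e.map_adj huv) with h | h <;>
    · have := Int.eq_zero_of_abs_lt_dvd h1 (by rw [abs_lt]; omega)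
      omega
  have hSsum : ∑ x, S x = ∑ _x : ZMod k, q := by
    simp only [S]
    rw [Finset.sum_comm]
    have : ∀ i ∈ Finset.range q, ∑ x : ZMod k, n (x + (i : ℕ)) = k := fun i _ =>
      (Equiv.sum_comp (Equiv.addRight ((i : ℕ) : ZMod k)) n).trans hn
    rw [Finset.sum_congr rfl this]
    simp [ZMod.card, mul_comm]
  have hSq : ∀ x, S x = q := fun x =>
    (Finset.sum_eq_sum_iff_of_le fun x _ => hSle x).1 hSsum x (Finset.mem_univ x)
  have hshift : ∀ x, n (x + (q : ℕ)) = n x := by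
    intro x
    have h1 : S x + n (x + (q : ℕ)) = S (x + 1) + n x := by
      have e1 := Finset.sum_range_succ (fun i : ℕ => n (x + (i : ℕ))) q
      have e2 := Finset.sum_range_succ' (fun i : ℕ => n (x + (i : ℕ))) q
      rw [e1] at e2
      simp only [S]
      rw [e2]
      simp [add_comm, add_left_comm]
    rw [hSq, hSq] at h1
    omega
  have hmul : ∀ m : ℕ, n ((m : ZMod k) * (q : ℕ)) = n 0 := by
    intro m
    induction m with
    | zero => simp
    | succ m ih => rw [← ih, ← hshift ((m : ZMod k) * (q : ℕ))]; congr 1; push_cast; ring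
  have hconst : ∀ x, n x = n 0 := by
    intro x
    rw [← hmul (x * (q : ZMod k)⁻¹).val]
    congr 1
    rw [ZMod.natCast_zmod_val, mul_assoc, mul_comm _ ((q : ℕ) : ZMod k),
      ZMod.coe_mul_inv_eq_one q (by rwa [Nat.Coprime, Nat.gcd_comm]), mul_one]
  have hn0 : n 0 = 1 := by
    simp only [hconst] at hn
    rw [Finset.sum_const, Finset.card_univ, ZMod.card, smul_eq_mul] at hn
    exact Nat.eq_of_mul_eq_mul_left hk0 (by rw [hn, mul_one])
  refine (Finite.injective_iff_bijective.1 (Finite.injective_iff_surjective.2 fun y => ?_))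
  have hy : 0 < n ((y : ℕ) : ZMod k) := by rw [hconst, hn0]; exact one_pos
  obtain ⟨v, hv⟩ := Finset.card_pos.1 hy
  have hv := (Finset.mem_filter.1 hv).2
  rw [ZMod.natCast_eq_natCast_iff', Nat.mod_eq_of_lt (e v).2, Nat.mod_eq_of_lt y.2] at hv
  exact ⟨v, Fin.ext hv⟩

/-- The inverse of a bijective endomorphism of a finite graph is an endomorphism. -/
theorem adj_symm_of_endo {V : Type*} [Finite V] {G : SimpleGraph V} (E : Equiv.Perm V)
    (hE : ∀ u v, G.Adj u v → G.Adj (E u) (E v)) (u v : V) (h : G.Adj u v) :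
    G.Adj (E.symm u) (E.symm v) := by
  have hpow : ∀ m : ℕ, ∀ u v, G.Adj u v → G.Adj ((E ^ m) u) ((E ^ m) v) := by
    intro m
    induction m with
    | zero => simp
    | succ m ih =>
      intro u v h
      rw [pow_succ, Equiv.Perm.mul_apply, Equiv.Perm.mul_apply]
      exact ih _ _ (hE u v h)
  have hinv : E⁻¹ = E ^ (orderOf E - 1) := by
    rw [inv_eq_iff_mul_eq_one, ← pow_succ', Nat.sub_add_cancel (orderOf_pos E), pow_orderOf_eq_one]
  have := hpow (orderOf E - 1) u v h
  rwa [← hinv] at this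

end Core

/-! ### Extending far-apart precolourings along walks. -/

section Extension

variable {V W α ι : Type*} {G : SimpleGraph W} {R : α → α → Prop}

/-- A connection as a sequence of steps that is eventually constant. -/
theorem HomConn.exists_seq {f g : W → α} (h : HomConn G R f g)
    (hg : ∀ u v, G.Adj u v → R (g u) (g v)) :
    ∃ (N : ℕ) (P : ℕ → W → α), P 0 = f ∧ (∀ n, N ≤ n → P n = g) ∧
      ∀ n, HomStep G R (P n) (P (n + 1)) := by
  induction h using Relation.ReflTransGen.head_induction_on with
  | refl => exact ⟨0, fun _ => g, rfl, fun _ _ => rfl, fun _ u v huv =>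
      ⟨hg u v huv, hg u v huv, hg u v huv⟩⟩
  | @head f f' hs _ ih =>
    obtain ⟨N, P, h0, hN, hP⟩ := ih
    refine ⟨N + 1, fun n => n.casesOn f P, rfl, fun n hn => ?_, fun n => ?_⟩
    · obtain ⟨m, rfl⟩ : ∃ m, n = m + 1 := ⟨n - 1, by omega⟩
      exact hN m (by omega)
    · cases n with
      | zero =>
        change HomStep G R f (P 0)
        rwa [h0]
      | succ n => exact hP n

/-- Colour each vertex according to its distance from the far-apart sets `A i`, along a walk of
homomorphisms that ends in `h₀`. -/
theorem exists_hom_of_seq (hR : ∀ x y, R x y → R y x) (X : SimpleGraph V) (c : X →g G)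
    (h₀ : W → α) (hh₀ : ∀ u v, G.Adj u v → R (h₀ u) (h₀ v)) (D : ℕ) (A : ι → Set V)
    (hA : ∀ i j, i ≠ j → ∀ a ∈ A i, ∀ b ∈ A j, ((2 * D : ℕ) : ℕ∞) ≤ X.edist a b)
    (P : ι → ℕ → W → α) (hPD : ∀ i, P i D = h₀) (hP : ∀ i n, HomStep G R (P i n) (P i (n + 1))) :
    ∃ F : V → α, (∀ u v, X.Adj u v → R (F u) (F v)) ∧ ∀ i, ∀ v ∈ A i, F v = P i 0 (c v) := by
  classical
  have hex : ∀ i v, ∃ m : ℕ, D ≤ m ∨ ∃ a ∈ A i, X.edist a v ≤ m := fun i v => ⟨D, .inl le_rfl⟩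
  -- `N i v` is the distance from `A i` to `v`, truncated at `D`.
  obtain ⟨N, hND, hNA, hNadj, hN0⟩ : ∃ N : ι → V → ℕ, (∀ i v, N i v ≤ D) ∧
      (∀ i v, N i v < D → ∃ a ∈ A i, X.edist a v ≤ N i v) ∧
      (∀ i u v, X.Adj u v → N i v ≤ N i u + 1) ∧ ∀ i, ∀ v ∈ A i, N i v = 0 := by
    refine ⟨fun i v => Nat.find (hex i v), fun i v => Nat.find_min' _ (.inl le_rfl),
      fun i v h => (Nat.find_spec (hex i v)).resolve_left (not_le.2 h), fun i u v huv => ?_,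
      fun i v hv => ?_⟩
    · refine Nat.find_min' _ ?_
      rcases Nat.find_spec (hex i u) with h | ⟨a, ha, h⟩
      · exact .inl (h.trans (Nat.le_succ _))
      · refine .inr ⟨a, ha, (SimpleGraph.edist_triangle (v := u)).trans ?_⟩
        rw [SimpleGraph.edist_eq_one_iff_adj.2 huv]
        push_cast
        gcongr
    · exact Nat.le_zero.1 (Nat.find_min' _ (.inr ⟨v, hv, by simp⟩))
  -- Two sets influencing the same edge would be at distance at most `2 (D - 1) + 1 < 2 D`.
  have huniq : ∀ i j u v, X.edist u v ≤ 1 → N i u < D → N j v < D → i = j := by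
    intro i j u v huv hi hj
    by_contra hij
    obtain ⟨a, ha, hau⟩ := hNA i u hi
    obtain ⟨b, hb, hbv⟩ := hNA j v hj
    have h1 : X.edist a b ≤ ((N i u + (1 + N j v) : ℕ) : ℕ∞) := by
      refine (SimpleGraph.edist_triangle (v := u)).trans ?_
      push_cast
      refine add_le_add hau ((SimpleGraph.edist_triangle (v := v)).trans (add_le_add huv ?_))
      rwa [SimpleGraph.edist_comm]
    have h2 := (hA i j hij a ha b hb).trans h1
    have h3 : 2 * D ≤ N i u + (1 + N j v) := by exact_mod_cast h2
    omega
  obtain ⟨F, hF, hF₀⟩ : ∃ F : V → α,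
      (∀ i v, (∀ j, j ≠ i → D ≤ N j v) → F v = P i (N i v) (c v)) ∧
      ∀ v, (∀ j, D ≤ N j v) → F v = h₀ (c v) := by
    refine ⟨fun v => if h : ∃ i, N i v < D then P h.choose (N h.choose v) (c v) else h₀ (c v),
      fun i v hi => ?_, fun v hv => ?_⟩
    · dsimp only
      split_ifs with h
      · have : h.choose = i := by
          by_contra hne
          exact absurd h.choose_spec (not_lt.2 (hi _ hne))
        rw [this]
      · push Not at h
        rw [le_antisymm (hND i v) (h i), hPD]
    · exact dif_neg (by simpa using hv)
  refine ⟨F, fun u v huv => ?_, fun i v hv => ?_⟩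
  · have hd : X.edist u v ≤ 1 := (SimpleGraph.edist_eq_one_iff_adj.2 huv).le
    have hcuv := c.map_adj huv
    by_cases h : ∃ i, N i u < D ∨ N i v < D
    · obtain ⟨i, hi⟩ := h
      have hu : ∀ j, j ≠ i → D ≤ N j u := by
        intro j hj
        by_contra! hlt
        rcases hi with hi | hi
        · exact hj (huniq j i u u (by simp) hlt hi)
        · exact hj (huniq j i u v hd hlt hi)
      have hv : ∀ j, j ≠ i → D ≤ N j v := by
        intro j hj
        by_contra! hlt
        rcases hi with hi | hi
        · exact hj (huniq i j u v hd hi hlt).symm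
        · exact hj (huniq j i v v (by simp) hlt hi)
      rw [hF i u hu, hF i v hv]
      have h1 := hNadj i u v huv
      have h2 := hNadj i v u huv.symm
      obtain h | h | h : N i v = N i u ∨ N i v = N i u + 1 ∨ N i u = N i v + 1 := by omega
      · rw [h]; exact (hP i _ hcuv).1
      · rw [h]; exact (hP i _ hcuv).2.2
      · rw [h]; exact hR _ _ (hP i _ hcuv.symm).2.2
    · push Not at h
      rw [hF₀ u fun j => (h j).1, hF₀ v fun j => (h j).2]
      exact hh₀ _ _ hcuv
  · have h0 := hN0 i v hv
    rw [hF i v fun j hj => ?_, h0]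
    by_contra! hlt
    exact hj (huniq j i v v (by simp) hlt (by omega))

end Extension

/-! ### Translation to circular cliques and the main theorem. -/

theorem circAdj_of_circularClique_adj {p r : ℕ} {i j : Fin p} (h : (circularClique p r).Adj i j) :
    CircAdj p r ((i : ℕ) : ℤ) ((j : ℕ) : ℤ) := by
  rcases circularClique_adj_cases h with h | h
  · exact circAdj_of_lt (by omega) (by omega)
  · exact circAdj_of_gt (by omega) (by omega)

theorem circularClique_adj_of_circAdj {p r : ℕ} (hr : 0 < r) {i j : Fin p}
    (h : CircAdj p r ((i : ℕ) : ℤ) ((j : ℕ) : ℤ)) : (circularClique p r).Adj i j := by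
  have h1 := h.bounds (by omega) (by omega) (by omega)
  rcases lt_trichotomy (i : ℕ) j with hlt | heq | hgt
  · exact (circularClique_adj_of_lt hlt).2 (by omega)
  · omega
  · exact ((circularClique_adj_of_lt hgt).2 (by omega)).symm

theorem mainTheorem7 (k q k' q' : ℕ) (hq : 0 < q) (hq' : 0 < q') (hkq : 2 * q ≤ k)
    (hcop : Nat.gcd k q = 1)
    (hk' : max (((k : ℚ) + 1) / 2) ((⌈(k : ℚ) / (q : ℚ)⌉ : ℚ) + 1) ≤ (k' : ℚ) / (q' : ℚ)) :
    ∃ d : ℕ, ∀ (V : Type*) [Finite V] (X : SimpleGraph V),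
      Nonempty (CircularColoring X k q) →
      ∀ (t : ℕ) (Y : Fin t → X.Subgraph),
        (∀ i, Nonempty ((Y i).coe ≃g circularClique k q)) →
        (∀ i j, i ≠ j → Disjoint (Y i).verts (Y j).verts) →
        (∀ i j, i ≠ j → (d : ℕ∞) ≤ subgraphDist X (Y i) (Y j)) →
        ∀ f : (i : Fin t) → CircularColoring (Y i).coe k' q',
          ∃ F : CircularColoring X k' q', ∀ (i : Fin t) (v : (Y i).verts), F v = f i v := by
  have hqQ : (0 : ℚ) < q := by exact_mod_cast hq
  have hqQ' : (0 : ℚ) < q' := by exact_mod_cast hq'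
  have hk1 : (q' : ℤ) * (k + 1) ≤ 2 * k' := by
    have := (le_max_left _ _).trans hk'
    rw [div_le_div_iff₀ two_pos hqQ'] at this
    have : ((k : ℚ) + 1) * q' ≤ k' * 2 := this
    have : ((k : ℤ) + 1) * q' ≤ k' * 2 := by exact_mod_cast this
    linarith
  have hceil : ∃ z : ℤ, (k : ℤ) ≤ z * q ∧ z + 1 ≤ ((k' / q' : ℕ) : ℤ) := by
    refine ⟨⌈(k : ℚ) / q⌉, ?_, ?_⟩
    · have := Int.le_ceil ((k : ℚ) / q)
      rw [div_le_iff₀ hqQ] at this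
      exact_mod_cast this
    · have := (le_max_right _ _).trans hk'
      rw [le_div_iff₀ hqQ'] at this
      rw [Int.natCast_div, Int.le_ediv_iff_mul_le (by exact_mod_cast hq')]
      exact_mod_cast this
  obtain ⟨z, hz1, hz2⟩ := hceil
  have hk'0 : 0 < k' := by
    have : (0 : ℤ) < q' * (k + 1) := by positivity
    omega
  obtain ⟨h₀, hh₀, hconn⟩ := exists_forall_homConn (p := k') (r := q') (M := k' / q') hq hkq hcop
    (by exact_mod_cast hq') (by exact_mod_cast Nat.mul_div_le k' q')
    (by exact_mod_cast Nat.lt_mul_div_succ k' hq') hk1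
    -- The ceiling in the hypothesis supplies the extra colours needed for `q = 1` and `q = 2`.
    (by rintro rfl; push_cast at *; omega)
    (by
      rintro rfl
      have hodd : k % 2 = 1 := by
        by_contra h
        have : (2 : ℕ) ∣ Nat.gcd k 2 := Nat.dvd_gcd (by omega) dvd_rfl
        rw [hcop] at this
        omega
      push_cast at hz1
      omega)
  have hseq : ∀ φ : circularClique k q →g circularClique k' q', ∃ (N : ℕ) (P : ℕ → Fin k → ℤ),
      P 0 = (fun v => ((φ v : ℕ) : ℤ)) ∧ (∀ n, N ≤ n → P n = h₀) ∧
        ∀ n, HomStep (circularClique k q) (CircAdj k' q') (P n) (P (n + 1)) := fun φ =>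
    (hconn _ fun u v huv => circAdj_of_circularClique_adj (φ.map_adj huv)).exists_seq hh₀
  choose N P hP0 hPN hPs using hseq
  have : Finite (circularClique k q →g circularClique k' q') := DFunLike.finite _
  obtain ⟨D, hD⟩ := (Set.finite_range N).bddAbove
  refine ⟨2 * (D + 1), fun V _ X ⟨c⟩ t Y hY _ hdist f => ?_⟩
  have hg : ∀ i, ∃ g : circularClique k q →g circularClique k' q',
      ∀ v : (Y i).verts, g (c v) = f i v := by
    intro i
    obtain ⟨e⟩ := hY i
    -- The copy `Y i` followed by `c` is an endomorphism of `G_{k,q}`, hence an automorphism;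
    -- inverting it expresses `f i` through `c`.
    let η : circularClique k q →g circularClique k q :=
      (c.comp (Y i).hom).comp e.symm.toHom
    let E := Equiv.ofBijective η (circularClique_endo_bijective hq hkq hcop η)
    let E' : circularClique k q →g circularClique k q :=
      ⟨E.symm, fun {u v} h => adj_symm_of_endo E (fun _ _ h => η.map_adj h) u v h⟩
    refine ⟨((f i).comp e.symm.toHom).comp E', fun v => ?_⟩
    have h1 : E (e v) = c v := by
      change c ((Y i).hom (e.symm (e v))) = c v
      rw [e.symm_apply_apply]
      rfl
    have h2 : E.symm (c v) = e v := by rw [← h1, E.symm_apply_apply]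
    change f i (e.symm (E.symm (c v))) = f i v
    rw [h2, e.symm_apply_apply]
  choose g hg using hg
  obtain ⟨F, hF, hFA⟩ := exists_hom_of_seq (R := CircAdj k' q') CircAdj.symm X c h₀ hh₀ (D + 1)
    (fun i => (Y i).verts)
    (fun i j hij a ha b hb => (hdist i j hij).trans ((iInf₂_le a ha).trans (iInf₂_le b hb)))
    (fun i => P (g i)) (fun i => hPN _ _ ((hD ⟨g i, rfl⟩).trans D.le_succ)) (fun i => hPs (g i))
  have hk'Z : (0 : ℤ) < k' := by exact_mod_cast hk'0
  have hmod : ∀ x : ℤ, (x % k').toNat < k' := fun x => by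
    have := Int.emod_nonneg x hk'Z.ne'; have := Int.emod_lt_of_pos x hk'Z; omega
  have hcast : ∀ x : ℤ, ∃ a, (((x % k').toNat : ℕ) : ℤ) = x + a * k' := fun x =>
    ⟨-(x / k'), by
      rw [Int.toNat_of_nonneg (Int.emod_nonneg x hk'Z.ne')]
      have := Int.emod_add_mul_ediv x k'; linarith⟩
  refine ⟨⟨fun v => ⟨(F v % k').toNat, hmod _⟩, fun {u v} huv =>
    circularClique_adj_of_circAdj hq' ((hF u v huv).congr (hcast _) (hcast _))⟩, fun i v => ?_⟩
  apply Fin.ext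
  change (F v % k').toNat = (f i v : ℕ)
  rw [hFA i v v.2, hP0]
  simp only [hg]
  rw [Int.emod_eq_of_lt (by positivity) (by exact_mod_cast (f i v).2), Int.toNat_natCast]
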